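/- Let $p$ be a prime and let $\mathbb{Z}_p^\wedge$ be the ring of $p$-adic integers. For a finite group $\Gamma$ let $\mathcal{O}_p(\Gamma)$ be the category of $\Gamma$-orbits $\Gamma/P$ whose isotropy groups are $p$-groups (the trivial group included), with $\Gamma$-equivariant maps as morphisms. For a $\mathbb{Z}_p^\wedge[\Gamma]$-module $M$ let $F_M$ be the contravariant functor from $\mathcal{O}_p(\Gamma)$ to $\mathbb{Z}_p^\wedge$-modules with $F_M(\Gamma/1)=M$, on which $\operatorname{Aut}(\Gamma/1)\cong\Gamma$ acts through the given action (the right multiplication $x\mapsto xg$ induces $m\mapsto gm$), and $F_M(\Gamma/P)=0$ for $P\neq 1$. For $i\geq 0$ let \[\Lambda^i(\Gamma;M):=H^i(\mathcal{O}_p(\Gamma);F_M),\] where $H^i(\mathcal{C};-)$ is the $i$-th right derived functor of the inverse limit on the category of contravariant functors from $\mathcal{C}$ to $\mathbb{Z}_p^\wedge$-modules. Proposition. Let $X$ be a finite set, let $\Sigma_X$ be the group of permutations of $X$, and let $\mathbb{Z}_p^\wedge[X]$ be the permutation module with basis $X$. Then $\Lambda^i(\Sigma_X;\mathbb{Z}_p^\wedge[X])=0$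 for all $i\geq 2$. -/

import Mathlib

open CategoryTheory

universe u

noncomputable section

/-- An object `Γ ⧸ P` of the `p`-orbit category of the group `Γ`: it is recorded by the
subgroup `P`, which has to be a `p`-group (possibly trivial). -/
structure OrbitCat (p : ℕ) (Γ : Type u) [Group Γ] : Type u where
  /-- The isotropy group `P` of the orbit `Γ ⧸ P`. -/
  subgroup : Subgroup Γ
  isPGroup : IsPGroup p subgroup

namespace OrbitCat

/-- Morphisms `Γ ⧸ P ⟶ Γ ⧸ Q` are the `Γ`-equivariant maps. -/
instance (p : ℕ) (Γ : Type u) [Group Γ] : Category.{u} (OrbitCat p Γ) where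
  Hom S T := (Γ ⧸ S.subgroup) →[Γ] (Γ ⧸ T.subgroup)
  id S := MulActionHom.id Γ
  comp f g := g.comp f

/-- The `Γ`-equivariant map of orbits underlying a morphism. -/
def toMap {p : ℕ} {Γ : Type u} [Group Γ] {S T : OrbitCat p Γ} (f : S ⟶ T) :
    (Γ ⧸ S.subgroup) →[Γ] (Γ ⧸ T.subgroup) := f

variable {p : ℕ} {Γ : Type u} [Group Γ]

/-- An element `g` of `Γ` such that `f` sends the coset of `1` to the coset of `g`. -/
def rep {S T : OrbitCat p Γ} (f : S ⟶ T) : Γ :=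
  (toMap f ((1 : Γ) : Γ ⧸ S.subgroup)).out

lemma mk_rep {S T : OrbitCat p Γ} (f : S ⟶ T) :
    ((rep f : Γ) : Γ ⧸ T.subgroup) = toMap f ((1 : Γ) : Γ ⧸ S.subgroup) :=
  Quotient.out_eq' _

lemma toMap_mk {S T : OrbitCat p Γ} (f : S ⟶ T) (x : Γ) :
    toMap f (x : Γ ⧸ S.subgroup) = ((x * rep f : Γ) : Γ ⧸ T.subgroup) := by
  have h := (toMap f).map_smul x ((1 : Γ) : Γ ⧸ S.subgroup)
  rw [← mk_rep, MulAction.Quotient.smul_coe, MulAction.Quotient.smul_coe, smul_eq_mul,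
    smul_eq_mul, mul_one] at h
  exact h

lemma eq_of_mk_eq {T : OrbitCat p Γ} (hT : T.subgroup = ⊥) {a b : Γ}
    (h : (a : Γ ⧸ T.subgroup) = (b : Γ ⧸ T.subgroup)) : a = b := by
  rw [QuotientGroup.eq, hT, Subgroup.mem_bot] at h
  exact inv_mul_eq_one.mp h

/-- The source of a map to a free orbit is a free orbit. -/
lemma subgroup_eq_bot {S T : OrbitCat p Γ} (f : S ⟶ T) (hT : T.subgroup = ⊥) :
    S.subgroup = ⊥ := by
  rw [Subgroup.eq_bot_iff_forall]
  intro x hx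
  have h1 : ((x : Γ) : Γ ⧸ S.subgroup) = ((1 : Γ) : Γ ⧸ S.subgroup) := by
    rw [QuotientGroup.eq]
    simpa using hx
  have h2 := congrArg (toMap f) h1
  rw [toMap_mk, toMap_mk] at h2
  simpa using eq_of_mk_eq hT h2

lemma rep_id {S : OrbitCat p Γ} (hS : S.subgroup = ⊥) : rep (𝟙 S) = 1 :=
  eq_of_mk_eq hS (mk_rep (𝟙 S))

lemma rep_comp {S T U : OrbitCat p Γ} (f : S ⟶ T) (g : T ⟶ U) (hU : U.subgroup = ⊥) :
    rep (f ≫ g) = rep f * rep g := by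
  apply eq_of_mk_eq hU
  rw [mk_rep, ← toMap_mk, mk_rep]
  rfl

end OrbitCat

/-- The value of the functor `F_M` at the orbit `Γ ⧸ P`, as a submodule of `M`: it is all of `M`
if `P = 1`, and `0` otherwise. -/
def atomicValue {k : Type} [CommRing k] {p : ℕ} {Γ : Type u} [Group Γ] (M : Rep.{u} k Γ)
    (S : OrbitCat p Γ) : Submodule k M where
  carrier := {m | S.subgroup ≠ ⊥ → m = 0}
  add_mem' ha hb h := by rw [ha h, hb h, add_zero]
  zero_mem' _ := rfl
  smul_mem' c m hm h := by rw [hm h, smul_zero]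

/-- The map `F_M(Γ ⧸ Q) → F_M(Γ ⧸ P)` induced by `f : Γ ⧸ P → Γ ⧸ Q`. If `P = Q = 1`, then `f` is
the right multiplication by a unique `g` in `Γ`, and the map is the action of `g` on `M`.
If `Q ≠ 1`, then it is zero, as its source is. -/
def atomicMap {k : Type} [CommRing k] {p : ℕ} {Γ : Type u} [Group Γ] (M : Rep.{u} k Γ)
    {S T : OrbitCat p Γ} (f : S ⟶ T) : atomicValue M T →ₗ[k] atomicValue M S :=
  (M.ρ (OrbitCat.rep f)).restrict (p := atomicValue M T) (q := atomicValue M S)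
    fun m hm h => by
      rw [hm fun hT => h (OrbitCat.subgroup_eq_bot f hT), map_zero]

lemma coe_atomicMap {k : Type} [CommRing k] {p : ℕ} {Γ : Type u} [Group Γ] (M : Rep.{u} k Γ)
    {S T : OrbitCat p Γ} (f : S ⟶ T) (m : atomicValue M T) :
    (atomicMap M f m : M) = M.ρ (OrbitCat.rep f) m := rfl

/-- The contravariant functor `F_M` from the `p`-orbit category of `Γ` to `k`-modules. -/
def atomicFunctor {k : Type} [CommRing k] (p : ℕ) {Γ : Type u} [Group Γ] (M : Rep.{u} k Γ) :
    (OrbitCat p Γ)ᵒᵖ ⥤ ModuleCat.{u} k where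
  obj S := ModuleCat.of k (atomicValue M S.unop)
  map f := ModuleCat.ofHom (atomicMap M f.unop)
  map_id S := by
    refine ModuleCat.hom_ext (LinearMap.ext fun m => Subtype.ext ?_)
    change M.ρ (OrbitCat.rep (𝟙 S.unop)) (m : M) = m
    by_cases hS : S.unop.subgroup = ⊥
    · rw [OrbitCat.rep_id hS, map_one]
      rfl
    · rw [m.2 hS, map_zero]
  map_comp {S T U} f g := by
    refine ModuleCat.hom_ext (LinearMap.ext fun m => Subtype.ext ?_)
    change M.ρ (OrbitCat.rep (g.unop ≫ f.unop)) (m : M) =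
      M.ρ (OrbitCat.rep g.unop) (M.ρ (OrbitCat.rep f.unop) m)
    by_cases hS : S.unop.subgroup = ⊥
    · rw [OrbitCat.rep_comp _ _ hS, map_mul]
      rfl
    · rw [m.2 hS, map_zero, map_zero, map_zero]

instance grothendieckAbelianModuleCat (k : Type) [CommRing k] :
    IsGrothendieckAbelian.{u} (ModuleCat.{u} k) where
  ab5OfSize := ⟨fun J _ _ =>
    HasExactColimitsOfShape.domain_of_functor J (forget₂ (ModuleCat.{u} k) AddCommGrpCat.{u})⟩

instance grothendieckAbelianFunctor (C : Type u) [SmallCategory C] (k : Type) [CommRing k] :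
    IsGrothendieckAbelian.{u} (Cᵒᵖ ⥤ ModuleCat.{u} k) where
  ab5OfSize := ⟨fun _ _ _ => inferInstance⟩

instance limAdditive (C : Type u) [SmallCategory C] (k : Type) [CommRing k] :
    (Limits.lim : (Cᵒᵖ ⥤ ModuleCat.{u} k) ⥤ ModuleCat.{u} k).Additive :=
  haveI : (Functor.const Cᵒᵖ : ModuleCat.{u} k ⥤ (Cᵒᵖ ⥤ ModuleCat.{u} k)).Additive := {}
  Limits.constLimAdj.right_adjoint_additive

/-- `H^i(C; F)` for a contravariant functor `F` from a small category `C` to `k`-modules: the value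
at `F` of the `i`-th right derived functor of the inverse limit. -/
def higherLimit {C : Type u} [SmallCategory C] {k : Type} [CommRing k]
    (F : Cᵒᵖ ⥤ ModuleCat.{u} k) (i : ℕ) : ModuleCat.{u} k :=
  ((Limits.lim : (Cᵒᵖ ⥤ ModuleCat.{u} k) ⥤ ModuleCat.{u} k).rightDerived i).obj F

/-- The functors `Λ^i(Γ; M)` of Jackowski, McClure and Oliver, for a `ℤ_p[Γ]`-module `M`. -/
def Lambda (p : ℕ) [Fact p.Prime] (i : ℕ) (Γ : Type u) [Group Γ] (M : Rep.{u} ℤ_[p] Γ) :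
    ModuleCat.{u} ℤ_[p] :=
  higherLimit (atomicFunctor p M) i

end

/-!
Write `Γ` for the symmetric group of `X` and `k` for the `p`-adic integers. The higher limits of a
contravariant functor `F` on the orbit category are the groups `Ext(k, F)` out of the constant
functor, and all coefficient functors are of one kind (`supportedFunctor`): at `Γ ⧸ P` they take
the `P`-invariant functions on a `Γ`-set which vanish outside of a prescribed set of points
depending on `P`. Four facts about them carry the argument.

* Functions on the points whose stabilizer in `P` belongs to a convex family of subgroups are
  acyclic in positive degrees (`ConvexFamily.subsingleton_ext_support`). Modulo `p`, a transfer
  embeds them as a retract into functions on `(Γ ⧸ S) × Y`, for a Sylow subgroup `S`; Shapiro's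
  lemma (`subsingleton_ext_coinduced`) computes the `Ext` groups of the latter over the orbit
  category of `S`, which has a terminal object, so that the constant functor is projective.
  Nakayama's lemma lifts the vanishing to `k`, as all `Ext` groups are finitely generated.
* A functor on the orbit category of a group which vanishes at the subgroups containing a fixed
  normal `p`-subgroup is acyclic in all degrees (`subsingleton_ext_of_normal`).
* Hence the functions supported on the free points of the conjugates of one subgroup `P` are
  acyclic in all degrees if `N(P)` has a normal `p`-subgroup which is not contained in `P`
  (`subsingleton_ext_conjClass`).
* In the symmetric group, the permutations which centralize `P` and preserve each of its orbits
  form such a subgroup, provided that `P` is a `p`-group with a free orbit and moves some point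
  outside of that orbit (`not_orbitwiseCentralizer_le`).

The functor `F_M` of `M = k[X]` consists of the functions supported at `P = 1`. It is a subfunctor
of the functions on all points with trivial stabilizer in `P`, which are acyclic by the first
fact. The quotient, the functions on the free points of the subgroups `P ≠ 1`, is an extension of
a functor involving only special subgroups, those acting trivially outside of a free orbit, by one
involving only the others. The second of these is acyclic by the last two facts, one conjugacy
class at a time. For the first, all free points of a special subgroup form one orbit and special
subgroups are maximal among the subgroups with a free orbit; so it is the functor of functions on
a one-point set supported at the special subgroups, which is again covered by the first fact. So
the quotient is acyclic in positive degrees, and `Ext^i(k, F_M)` vanishes for `i ≥ 2`.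
-/

noncomputable section

open Abelian Limits Opposite
open scoped Pointwise ZeroObject

/-! ### Vanishing of `Ext` groups -/

universe w v v' w' u₁ u₂ w₂

section Ext

variable {𝒜 : Type u₁} [Category.{v} 𝒜] [Abelian 𝒜] [HasExt.{w} 𝒜]

lemma subsingleton_ext_one_iff {S : ShortComplex 𝒜} (hS : S.ShortExact) [Projective S.X₂]
    (A : 𝒜) :
    Subsingleton (Ext S.X₃ A 1) ↔ ∀ x : S.X₁ ⟶ A, ∃ y : S.X₂ ⟶ A, S.f ≫ y = x := by
  constructor
  · intro h x
    obtain ⟨y, hy⟩ := Ext.contravariant_sequence_exact₁ hS A (Ext.mk₀ x) (add_zero 1)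
      (Subsingleton.elim _ _)
    obtain ⟨y, rfl⟩ := (Ext.mk₀_bijective _ _).2 y
    rw [Ext.mk₀_comp_mk₀] at hy
    exact ⟨y, (Ext.mk₀_bijective _ _).1 hy⟩
  · intro h
    refine subsingleton_of_forall_eq 0 fun x => ?_
    obtain ⟨x₁, rfl⟩ := Ext.contravariant_sequence_exact₃ hS A x
      (Ext.eq_zero_of_projective _) (add_zero 1)
    obtain ⟨x₁, rfl⟩ := (Ext.mk₀_bijective _ _).2 x₁
    obtain ⟨y, rfl⟩ := h x₁
    rw [← Ext.mk₀_comp_mk₀, ← Ext.comp_assoc _ _ _ (add_zero 1) (zero_add 0) (by lia),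
      hS.extClass_comp, Ext.zero_comp]

lemma subsingleton_ext_succ_succ_iff {S : ShortComplex 𝒜} (hS : S.ShortExact)
    [Projective S.X₂] (A : 𝒜) (n : ℕ) :
    Subsingleton (Ext S.X₃ A (n + 2)) ↔ Subsingleton (Ext S.X₁ A (n + 1)) := by
  constructor
  · intro h
    refine subsingleton_of_forall_eq 0 fun x => ?_
    obtain ⟨y, rfl⟩ := Ext.contravariant_sequence_exact₁ hS A x (add_comm 1 (n + 1))
      (Subsingleton.elim _ _)
    rw [Ext.eq_zero_of_projective y, Ext.comp_zero]
  · intro h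
    refine subsingleton_of_forall_eq 0 fun x => ?_
    obtain ⟨x₁, rfl⟩ := Ext.contravariant_sequence_exact₃ hS A x
      (Ext.eq_zero_of_projective _) (add_comm 1 (n + 1))
    rw [Subsingleton.elim x₁ 0, Ext.comp_zero]

lemma subsingleton_ext_zero_iff (X A : 𝒜) :
    Subsingleton (Ext X A 0) ↔ Subsingleton (X ⟶ A) :=
  Ext.homEquiv₀.subsingleton_congr

lemma subsingleton_ext_X₂ {S : ShortComplex 𝒜} (hS : S.ShortExact) (X : 𝒜) (n : ℕ)
    [Subsingleton (Ext X S.X₁ n)] [Subsingleton (Ext X S.X₃ n)] :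
    Subsingleton (Ext X S.X₂ n) := by
  refine subsingleton_of_forall_eq 0 fun x => ?_
  obtain ⟨y, rfl⟩ := Ext.covariant_sequence_exact₂ X hS x (Subsingleton.elim _ _)
  rw [Subsingleton.elim y 0, Ext.zero_comp]

lemma subsingleton_ext_X₁ {S : ShortComplex 𝒜} (hS : S.ShortExact) (X : 𝒜) (n : ℕ)
    [Subsingleton (Ext X S.X₃ n)] [Subsingleton (Ext X S.X₂ (n + 1))] :
    Subsingleton (Ext X S.X₁ (n + 1)) := by
  refine subsingleton_of_forall_eq 0 fun x => ?_
  obtain ⟨y, rfl⟩ := Ext.covariant_sequence_exact₁ X hS x (Subsingleton.elim _ _) rfl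
  rw [Subsingleton.elim y 0, Ext.zero_comp]

lemma subsingleton_ext_of_retract {X F G : 𝒜} (s : F ⟶ G) (r : G ⟶ F) (h : s ≫ r = 𝟙 F)
    (n : ℕ) [Subsingleton (Ext X G n)] : Subsingleton (Ext X F n) := by
  refine subsingleton_of_forall_eq 0 fun x => ?_
  rw [← Ext.comp_mk₀_id x, ← h, ← Ext.mk₀_comp_mk₀,
    ← Ext.comp_assoc x (Ext.mk₀ s) (Ext.mk₀ r) (add_zero n) (zero_add 0) (by lia),
    Subsingleton.elim (x.comp (Ext.mk₀ s) (add_zero n)) 0, Ext.zero_comp]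

variable {ℬ : Type u₂} [Category.{v'} ℬ] [Abelian ℬ] [HasExt.{w'} ℬ]

/-- An exact functor `F` which sends enough projectives to projectives and for which `A`
represents `X ↦ (F X ⟶ G)` detects the vanishing of `Ext`. This is applied to restriction functors,
and only the one representing object `A` is needed, not a right adjoint of `F`. -/
lemma subsingleton_ext_iff_of_representable (F : 𝒜 ⥤ ℬ) [F.Additive]
    [PreservesFiniteLimits F] [PreservesFiniteColimits F] {A : 𝒜} {G : ℬ} (ε : F.obj A ⟶ G)
    (hε : ∀ X, Function.Bijective fun f : X ⟶ A => F.map f ≫ ε)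
    (hF : ∀ X : 𝒜, ∃ (Q : 𝒜) (q : Q ⟶ X), Epi q ∧ Projective Q ∧ Projective (F.obj Q))
    (n : ℕ) (X : 𝒜) :
    Subsingleton (Ext X A n) ↔ Subsingleton (Ext (F.obj X) G n) := by
  induction n generalizing X with
  | zero =>
    rw [subsingleton_ext_zero_iff, subsingleton_ext_zero_iff]
    exact (Equiv.ofBijective _ (hε X)).subsingleton_congr
  | succ n ih =>
    obtain ⟨Q, q, _, _, _⟩ := hF X
    let S := ShortComplex.mk (kernel.ι q) q (kernel.condition q)
    have hS : S.ShortExact :=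
      { exact := ShortComplex.exact_of_f_is_kernel _ (kernelIsKernel q) }
    have hS' : (S.map F).ShortExact := hS.map_of_exact F
    have : Projective S.X₂ := ‹Projective Q›
    have : Projective (S.map F).X₂ := ‹Projective (F.obj Q)›
    cases n with
    | zero =>
      change Subsingleton (Ext S.X₃ A 1) ↔ Subsingleton (Ext (S.map F).X₃ G 1)
      rw [subsingleton_ext_one_iff hS, subsingleton_ext_one_iff hS']
      constructor
      · intro h (x : F.obj S.X₁ ⟶ G)
        obtain ⟨x, rfl⟩ := (hε _).2 x
        obtain ⟨y, rfl⟩ := h x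
        exact ⟨F.map y ≫ ε, (F.map_comp_assoc S.f y ε).symm⟩
      · intro h x
        obtain ⟨(y : F.obj S.X₂ ⟶ G), hy⟩ := h (F.map x ≫ ε)
        obtain ⟨y, rfl⟩ := (hε _).2 y
        exact ⟨y, (hε _).1 ((F.map_comp_assoc S.f y ε).trans hy)⟩
    | succ n =>
      change Subsingleton (Ext S.X₃ A (n + 2)) ↔ Subsingleton (Ext (S.map F).X₃ G (n + 2))
      rw [subsingleton_ext_succ_succ_iff hS, subsingleton_ext_succ_succ_iff hS']
      exact ih S.X₁

/-- By Nakayama's lemma: if multiplication by an element `a` of the maximal ideal of `k` is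
injective on `F`, then the finitely generated `Ext` groups into `F` vanish as soon as those into
its cokernel do. -/
lemma subsingleton_ext_of_smul {k : Type w₂} [CommRing k] [IsLocalRing k] [Linear k 𝒜]
    {F G : 𝒜} (a : k) (ha : a ∈ IsLocalRing.maximalIdeal k) (g : F ⟶ G)
    (w : (a • 𝟙 F) ≫ g = 0) (hS : (ShortComplex.mk _ g w).ShortExact) (X : 𝒜) (n : ℕ)
    [Module.Finite k (Ext X F n)] [Subsingleton (Ext X G n)] :
    Subsingleton (Ext X F n) := by
  have h : (⊤ : Submodule k (Ext X F n)) ≤ Ideal.span {a} • ⊤ := by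
    intro x _
    obtain ⟨y, rfl⟩ := Ext.covariant_sequence_exact₂ X hS x (Subsingleton.elim _ _)
    change y.comp (Ext.mk₀ (a • 𝟙 F)) (add_zero n) ∈ _
    rw [← Ext.smul_eq_comp_mk₀]
    exact Submodule.smul_mem_smul (Ideal.mem_span_singleton_self a) trivial
  have := Submodule.eq_bot_of_le_smul_of_le_jacobson_bot (Ideal.span {a}) ⊤
    Module.Finite.fg_top h
    ((Ideal.span_singleton_le_iff_mem _).2 (IsLocalRing.maximalIdeal_le_jacobson _ ha))
  exact (Submodule.subsingleton_iff k).1 (subsingleton_of_bot_eq_top this.symm)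

end Ext

/-! ### Contravariant functors on a small category -/

section FreeFunctor

variable {C D : Type u} [SmallCategory C] [SmallCategory D] (k : Type) [CommRing k]

instance hasExtFunctor : HasExt.{u} (Cᵒᵖ ⥤ ModuleCat.{u} k) :=
  hasExt_of_enoughInjectives.{u} _

/-- The free contravariant functor `⨁ i, k[Hom(-, d i)]` on a family of objects. -/
def freeFunctor {ι : Type u} (d : ι → C) : Cᵒᵖ ⥤ ModuleCat.{u} k where
  obj c := ModuleCat.of k ((Σ i, (c.unop ⟶ d i)) →₀ k)
  map f := ModuleCat.ofHom (Finsupp.lmapDomain k k fun z => ⟨z.1, f.unop ≫ z.2⟩)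
  map_id c := by
    ext z
    simp
  map_comp f g := by
    ext z
    simp

lemma freeFunctor_map_single {ι : Type u} (d : ι → C) {a b : Cᵒᵖ} (f : a ⟶ b) (i : ι)
    (z : a.unop ⟶ d i) (r : k) :
    (freeFunctor k d).map f (Finsupp.single ⟨i, z⟩ r : (Σ i, (a.unop ⟶ d i)) →₀ k) =
      (Finsupp.single ⟨i, f.unop ≫ z⟩ r : (Σ i, (b.unop ⟶ d i)) →₀ k) :=
  Finsupp.mapDomain_single

variable {k} in
lemma functor_map_comp_apply (M : Cᵒᵖ ⥤ ModuleCat.{u} k) {a b c : C} (f : a ⟶ b) (g : b ⟶ c)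
    (m : M.obj (op c)) : M.map (f ≫ g).op m = M.map f.op (M.map g.op m) := by
  rw [op_comp, M.map_comp]
  rfl

variable {k} in
lemma functor_naturality_apply {M N : Cᵒᵖ ⥤ ModuleCat.{u} k} (α : M ⟶ N) {a b : C} (f : a ⟶ b)
    (m : M.obj (op b)) : α.app (op a) (M.map f.op m) = N.map f.op (α.app (op b) m) :=
  NatTrans.naturality_apply α f.op m

variable {k} in
lemma functor_epi_surjective {M N : Cᵒᵖ ⥤ ModuleCat.{u} k} (α : M ⟶ N) [Epi α] (c : Cᵒᵖ) :
    Function.Surjective (α.app c) :=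
  (ModuleCat.epi_iff_surjective _).1 ((NatTrans.epi_iff_epi_app α).1 ‹_› c)

/-- A functor `E : D ⥤ C` is a left multiadjoint if each functor `Hom(E -, c)` is a disjoint union
of representable functors. -/
def IsLeftMultiadjoint (E : D ⥤ C) : Prop :=
  ∀ c : C, ∃ (J : Type u) (e : J → D) (y : ∀ j, E.obj (e j) ⟶ c),
    ∀ (b : D) (f : E.obj b ⟶ c), ∃! q : Σ j, (b ⟶ e j), E.map q.2 ≫ y q.1 = f

lemma isLeftMultiadjoint_id : IsLeftMultiadjoint (𝟭 C) := fun c =>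
  ⟨PUnit, fun _ => c, fun _ => 𝟙 c, fun b f => ⟨⟨⟨⟩, f⟩, by simp, fun ⟨_, g⟩ h => by
    rw [← show g = f by simpa using h]⟩⟩

/-- The restriction of a free functor along a left multiadjoint is free, hence projective. -/
lemma projective_precomp_freeFunctor {E : D ⥤ C} (hE : IsLeftMultiadjoint E) {ι : Type u}
    (d : ι → C) : Projective (E.op ⋙ freeFunctor k d) where
  factors {N M} φ α _ := by
    choose J e y hy using fun i => hE (d i)
    have hs : ∀ i (j : J i), ∃ m : N.obj (op (e i j)), α.app _ m =
        φ.app (op (e i j)) (Finsupp.single ⟨i, y i j⟩ 1 : (Σ l, (E.obj (e i j) ⟶ d l)) →₀ k) :=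
      fun i j => functor_epi_surjective α _ _
    choose m hm using hs
    choose q hq hq' using hy
    let ψ (b : Dᵒᵖ) : (Σ i, (E.obj b.unop ⟶ d i)) → N.obj b := fun z =>
      N.map (q z.1 b.unop z.2).2.op (m z.1 (q z.1 b.unop z.2).1)
    refine ⟨{ app := fun b => ModuleCat.ofHom (Finsupp.lift (N.obj b) k _ (ψ b)),
              naturality := fun b b' f => ?_ }, ?_⟩
    · refine ModuleCat.hom_ext (Finsupp.lhom_ext' fun ⟨i, z⟩ => LinearMap.ext_ring ?_)
      change Finsupp.lift (N.obj b') k _ (ψ b') (Finsupp.mapDomain _ (Finsupp.single _ 1)) =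
        N.map f (Finsupp.lift (N.obj b) k _ (ψ b) (Finsupp.single _ 1))
      have hz : q i b'.unop (E.map f.unop ≫ z) =
          ⟨(q i b.unop z).1, f.unop ≫ (q i b.unop z).2⟩ :=
        (hq' i _ _ _ (by
          change E.map (f.unop ≫ _) ≫ _ = _
          rw [E.map_comp, Category.assoc, hq])).symm
      rw [Finsupp.mapDomain_single]
      simp only [Finsupp.lift_apply, Finsupp.sum_single_index, zero_smul, one_smul]
      change N.map (q i b'.unop (E.map f.unop ≫ z)).2.op (m i _) = N.map f (N.map _ _)
      rw [hz]
      exact functor_map_comp_apply N _ _ _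
    · ext b : 2
      refine ModuleCat.hom_ext (Finsupp.lhom_ext' fun ⟨i, z⟩ => LinearMap.ext_ring ?_)
      change α.app b (Finsupp.lift (N.obj b) k _ (ψ b) (Finsupp.single _ 1)) =
        φ.app b (Finsupp.single _ 1)
      simp only [Finsupp.lift_apply, Finsupp.sum_single_index, zero_smul, one_smul]
      change α.app (op b.unop) (N.map (q i b.unop z).2.op (m i _)) = _
      rw [functor_naturality_apply, hm]
      refine (functor_naturality_apply φ _ _).symm.trans ?_
      change φ.app b ((freeFunctor k d).map (E.map _).op _) = _
      rw [freeFunctor_map_single]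
      congr 3
      exact hq i b.unop z

instance projective_freeFunctor {ι : Type u} (d : ι → C) : Projective (freeFunctor k d) :=
  projective_precomp_freeFunctor k isLeftMultiadjoint_id d

variable {k}

/-- The morphism from a free functor given by the images of the generators. -/
def freeFunctorDesc {ι : Type u} (d : ι → C) (M : Cᵒᵖ ⥤ ModuleCat.{u} k)
    (x : ∀ i, M.obj (op (d i))) : freeFunctor k d ⟶ M where
  app c := ModuleCat.ofHom (Finsupp.lift (M.obj c) k _ fun z => M.map z.2.op (x z.1))
  naturality a b f := by
    refine ModuleCat.hom_ext (Finsupp.lhom_ext' fun ⟨i, z⟩ => LinearMap.ext_ring ?_)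
    change Finsupp.lift (M.obj b) k _ _ (Finsupp.mapDomain _ (Finsupp.single _ 1)) =
        M.map f (Finsupp.lift (M.obj a) k _ _ (Finsupp.single _ 1))
    rw [Finsupp.mapDomain_single]
    simp only [Finsupp.lift_apply, Finsupp.sum_single_index, zero_smul, one_smul]
    exact functor_map_comp_apply M f.unop z (x i)

lemma freeFunctorDesc_app_single {ι : Type u} (d : ι → C) (M : Cᵒᵖ ⥤ ModuleCat.{u} k)
    (x : ∀ i, M.obj (op (d i))) (i : ι) :
    (freeFunctorDesc d M x).app (op (d i))
      (Finsupp.single ⟨i, 𝟙 (d i)⟩ 1 : (Σ j, (d i ⟶ d j)) →₀ k) = x i := by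
  change Finsupp.lift (M.obj (op (d i))) k _ _ (Finsupp.single _ 1) = _
  simp only [Finsupp.lift_apply, Finsupp.sum_single_index, zero_smul, one_smul]
  rw [op_id, M.map_id]
  rfl

lemma epi_freeFunctorDesc {ι : Type u} (d : ι → C) (M : Cᵒᵖ ⥤ ModuleCat.{u} k)
    (x : ∀ i, M.obj (op (d i)))
    (hx : ∀ c : C, ⊤ ≤ Submodule.span k {m : M.obj (op c) | ∃ (i : ι) (h : d i = c), h ▸ x i = m}) :
    Epi (freeFunctorDesc d M x) := by
  refine (NatTrans.epi_iff_epi_app _).2 fun ⟨c⟩ => (ModuleCat.epi_iff_surjective _).2 ?_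
  have : LinearMap.range ((freeFunctorDesc d M x).app (op c)).hom = ⊤ := by
    refine top_unique ((hx c).trans (Submodule.span_le.2 ?_))
    rintro _ ⟨i, rfl, rfl⟩
    exact ⟨_, freeFunctorDesc_app_single d M x i⟩
  exact LinearMap.range_eq_top.1 this

/-- The functor category has enough free functors. -/
lemma exists_epi_freeFunctor (M : Cᵒᵖ ⥤ ModuleCat.{u} k) :
    ∃ (ι : Type u) (d : ι → C) (q : freeFunctor k d ⟶ M), Epi q :=
  ⟨Σ c : C, M.obj (op c), Sigma.fst, freeFunctorDesc _ _ Sigma.snd,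
    epi_freeFunctorDesc _ _ _ fun c m _ => Submodule.subset_span ⟨⟨c, m⟩, rfl, rfl⟩⟩

/-- Restriction along `E : D ⥤ C` of contravariant functors. -/
abbrev restrictFunctor (k : Type) [CommRing k] (E : D ⥤ C) :
    (Cᵒᵖ ⥤ ModuleCat.{u} k) ⥤ (Dᵒᵖ ⥤ ModuleCat.{u} k) :=
  (Functor.whiskeringLeft _ _ _).obj E.op

/-- If `A` represents `X ↦ Hom(X ∘ E, G)` for a left multiadjoint `E`, then `Ext(X, A)` vanishes
exactly where `Ext(X ∘ E, G)` does. -/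
lemma subsingleton_ext_restrict_iff {E : D ⥤ C} (hE : IsLeftMultiadjoint E)
    {A : Cᵒᵖ ⥤ ModuleCat.{u} k} {G : Dᵒᵖ ⥤ ModuleCat.{u} k} (ε : E.op ⋙ A ⟶ G)
    (hε : ∀ X, Function.Bijective fun f : X ⟶ A => (restrictFunctor k E).map f ≫ ε)
    (n : ℕ) (X : Cᵒᵖ ⥤ ModuleCat.{u} k) :
    Subsingleton (Ext X A n) ↔ Subsingleton (Ext (E.op ⋙ X) G n) := by
  have : (restrictFunctor k E).Additive := {}
  refine subsingleton_ext_iff_of_representable (restrictFunctor k E) ε hε (fun Y => ?_) n X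
  obtain ⟨ι, d, q, hq⟩ := exists_epi_freeFunctor Y
  exact ⟨_, q, hq, inferInstance, projective_precomp_freeFunctor k hE d⟩

/-- Between pointwise finitely generated functors on a finite category, over a noetherian ring,
the `Ext` groups are finitely generated. -/
lemma finite_ext [IsNoetherianRing k] [Finite C] [∀ a b : C, Finite (a ⟶ b)] (n : ℕ)
    (X F : Cᵒᵖ ⥤ ModuleCat.{u} k) (hX : ∀ c, Module.Finite k (X.obj c))
    (hF : ∀ c, Module.Finite k (F.obj c)) : Module.Finite k (Ext X F n) := by
  induction n generalizing X with
  | zero =>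
    let φ : (X ⟶ F) →ₗ[k] ∀ c, (X.obj c →ₗ[k] F.obj c) :=
      { toFun := fun f c => (f.app c).hom
        map_add' := fun _ _ => rfl
        map_smul' := fun _ _ => rfl }
    have : Module.Finite k (X ⟶ F) := by
      have := Finite.of_equiv C equivToOpposite
      refine Module.Finite.of_injective φ fun f g h => ?_
      ext c : 2
      exact ModuleCat.hom_ext (congrFun h c)
    exact Module.Finite.equiv (Ext.linearEquiv₀ (R := k)).symm
  | succ n ih =>
    choose s hs using fun c => (hX c).fg_top
    let ι := Σ c : C, {m : X.obj (op c) // m ∈ s (op c)}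
    let d : ι → C := Sigma.fst
    let q := freeFunctorDesc d X fun i => i.2.1
    have : Epi q := epi_freeFunctorDesc _ _ _ fun c => by
      rw [← hs (op c)]
      exact Submodule.span_mono fun m hm => ⟨⟨c, m, hm⟩, rfl, rfl⟩
    let S := ShortComplex.mk (kernel.ι q) q (kernel.condition q)
    have hS : S.ShortExact :=
      { exact := ShortComplex.exact_of_f_is_kernel _ (kernelIsKernel q) }
    have hK : ∀ c, Module.Finite k (S.X₁.obj c) := fun c => by
      have : Module.Finite k ((freeFunctor k d).obj c) := by
        change Module.Finite k ((Σ i, (c.unop ⟶ d i)) →₀ k)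
        have : Finite ι := inferInstance
        infer_instance
      have hm : Mono (S.f.app c) := (NatTrans.mono_iff_mono_app S.f).1 inferInstance c
      exact Module.Finite.of_injective (S.f.app c).hom ((ModuleCat.mono_iff_injective _).1 hm)
    have := ih S.X₁ hK
    have : Projective S.X₂ := projective_freeFunctor k d
    let δ : Ext S.X₁ F n →ₗ[k] Ext S.X₃ F (n + 1) :=
      { toFun := fun x => hS.extClass.comp x (add_comm 1 n)
        map_add' := fun x y => Ext.comp_add _ _ _ _
        map_smul' := fun r x => Ext.comp_smul _ _ _ _ }
    refine Module.Finite.of_surjective δ fun x => ?_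
    exact Ext.contravariant_sequence_exact₃ hS F x (Ext.eq_zero_of_projective _) (add_comm 1 n)

end FreeFunctor

section Constant

variable (C : Type u) [SmallCategory C] (k : Type) [CommRing k]

/-- The constant contravariant functor with value the free module of rank one. -/
abbrev constFunctor : Cᵒᵖ ⥤ ModuleCat.{u} k :=
  (Functor.const Cᵒᵖ).obj (ModuleCat.of k (ULift.{u} k))

variable {C k}

lemma projective_constFunctor {T : C} (hT : IsTerminal T) : Projective (constFunctor C k) where
  factors {N M} φ α _ := by
    obtain ⟨m, hm⟩ := functor_epi_surjective α (op T) (φ.app (op T) (ULift.up 1 : ULift k))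
    refine ⟨{ app := fun c => ModuleCat.ofHom
                (LinearMap.toSpanSingleton k _ (N.map (hT.from c.unop).op m) ∘ₗ
                  ULift.moduleEquiv.toLinearMap),
              naturality := fun a b f => ?_ }, ?_⟩
    · refine ModuleCat.hom_ext (LinearMap.ext fun r => ?_)
      change r.down • N.map (hT.from b.unop).op m = N.map f (r.down • N.map (hT.from a.unop).op m)
      rw [map_smul]
      congr 1
      rw [← hT.comp_from f.unop]
      exact functor_map_comp_apply N _ _ _
    · ext c : 2
      refine ModuleCat.hom_ext (LinearMap.ext fun r => ?_)
      change α.app c (r.down • N.map (hT.from c.unop).op m) = φ.app c r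
      have h : (r : ULift k) = r.down • (ULift.up 1 : ULift k) :=
        ULift.ext _ _ (mul_one r.down).symm
      refine Eq.trans ?_ (congrArg (φ.app c) h).symm
      rw [map_smul]
      refine Eq.trans (congrArg (r.down • ·) ?_) (map_smul _ _ _).symm
      refine (functor_naturality_apply α (hT.from c.unop) m).trans ?_
      rw [hm]
      exact (functor_naturality_apply φ (hT.from c.unop) _).symm

/-- The higher limits of `F` vanish in the degrees in which `Ext(k, F)` does. -/
lemma isZero_higherLimit (F : Cᵒᵖ ⥤ ModuleCat.{u} k) (n : ℕ)
    [Subsingleton (Ext (constFunctor C k) F (n + 1))] : IsZero (higherLimit F (n + 1)) := by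
  let I := InjectiveResolution.of F
  refine IsZero.of_iso ?_ (I.isoRightDerivedObj Limits.lim (n + 1))
  refine (HomologicalComplex.exactAt_iff_isZero_homology _ _).1 ?_
  rw [HomologicalComplex.exactAt_iff' _ n (n + 1) (n + 2) (by simp) (by simp)]
  rw [ShortComplex.moduleCat_exact_iff]
  intro x hx
  change (lim.obj (I.cocomplex.X (n + 1)) : ModuleCat k) at x
  change lim.map (I.cocomplex.d (n + 1) (n + 2)) x = 0 at hx
  change ∃ y : (lim.obj (I.cocomplex.X n) : ModuleCat k), lim.map (I.cocomplex.d n (n + 1)) y = x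
  let f₀ : ModuleCat.of k (ULift.{u} k) ⟶ lim.obj (I.cocomplex.X (n + 1)) :=
    ModuleCat.ofHom (LinearMap.toSpanSingleton k _ x ∘ₗ ULift.moduleEquiv.toLinearMap)
  have hf₀ : f₀ ≫ lim.map (I.cocomplex.d (n + 1) (n + 2)) = 0 := by
    refine ModuleCat.hom_ext (LinearMap.ext fun r => ?_)
    change lim.map (I.cocomplex.d (n + 1) (n + 2)) (r.down • x) = 0
    rw [map_smul, hx, smul_zero]
  let f : constFunctor C k ⟶ I.cocomplex.X (n + 1) := (constLimAdj.homEquiv _ _).symm f₀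
  have hf : f ≫ I.cocomplex.d (n + 1) (n + 2) = 0 := by
    rw [← Adjunction.homEquiv_naturality_right_symm, hf₀]
    rw [Equiv.symm_apply_eq, Adjunction.homEquiv_unit, Functor.map_zero, comp_zero]
  obtain ⟨g, hg⟩ := (I.extMk_eq_zero_iff f (n + 2) rfl hf n rfl).1 (Subsingleton.elim _ _)
  refine ⟨constLimAdj.homEquiv _ _ g (ULift.up 1 : ULift k), ?_⟩
  have := constLimAdj.homEquiv_naturality_right g (I.cocomplex.d n (n + 1))
  rw [hg, Equiv.apply_symm_apply] at this
  have := congr($this (ULift.up 1 : ULift k))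
  refine this.symm.trans ?_
  change (1 : k) • x = x
  exact one_smul _ _

end Constant

/-! ### The orbit category and functions with prescribed support -/

section Orbits

lemma mem_conj_smul {G : Type*} [Group G] (g x : G) (P : Subgroup G) :
    x ∈ MulAut.conj g • P ↔ g⁻¹ * x * g ∈ P := by
  rw [Subgroup.mem_pointwise_smul_iff_inv_smul_mem, ← map_inv]
  simp [MulAut.smul_def]

lemma conj_smul_of_mem {G : Type*} [Group G] {g : G} {P : Subgroup G} (hg : g ∈ P) :
    MulAut.conj g • P = P := Subgroup.conj_smul_eq_self_of_mem hg

namespace OrbitCat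

variable {p : ℕ} {Γ : Type u} [Group Γ]

lemma hom_ext_one {S T : OrbitCat p Γ} {f g : S ⟶ T}
    (h : toMap f ((1 : Γ) : Γ ⧸ S.subgroup) = toMap g ((1 : Γ) : Γ ⧸ S.subgroup)) : f = g := by
  have h' : toMap f = toMap g := by
    refine MulActionHom.ext fun x => ?_
    induction x using QuotientGroup.induction_on with
    | H x =>
      have e : ((x : Γ) : Γ ⧸ S.subgroup) = x • ((1 : Γ) : Γ ⧸ S.subgroup) := by
        rw [MulAction.Quotient.smul_coe, smul_eq_mul, mul_one]
      rw [e, map_smul, map_smul, h]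
  exact h'

lemma toMap_comp {S T U : OrbitCat p Γ} (f : S ⟶ T) (g : T ⟶ U) (x : Γ ⧸ S.subgroup) :
    toMap (f ≫ g) x = toMap g (toMap f x) := rfl

lemma subgroup_le_conj_rep {S T : OrbitCat p Γ} (f : S ⟶ T) :
    S.subgroup ≤ MulAut.conj (rep f) • T.subgroup := by
  intro s hs
  have h : ((s : Γ) : Γ ⧸ S.subgroup) = ((1 : Γ) : Γ ⧸ S.subgroup) := by
    rw [eq_comm, QuotientGroup.eq]
    simpa using hs
  have h2 := congrArg (toMap f) h
  rw [toMap_mk, toMap_mk, eq_comm, QuotientGroup.eq] at h2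
  rw [mem_conj_smul]
  simpa [mul_assoc] using h2

/-- The morphism `Γ ⧸ S ⟶ Γ ⧸ T` given by right multiplication by `a`. -/
def homMk {S T : OrbitCat p Γ} (a : Γ) (h : S.subgroup ≤ MulAut.conj a • T.subgroup) : S ⟶ T :=
  ({ toFun := Quotient.map' (· * a) fun x y hxy => by
        rw [QuotientGroup.leftRel_apply] at hxy ⊢
        have := h hxy
        rw [mem_conj_smul] at this
        simpa [mul_assoc] using this
     map_smul' := fun g x => by
        induction x using QuotientGroup.induction_on with
        | H x => exact congrArg (QuotientGroup.mk (s := T.subgroup)) (mul_assoc g x a) } :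
    (Γ ⧸ S.subgroup) →[Γ] (Γ ⧸ T.subgroup))

lemma toMap_homMk {S T : OrbitCat p Γ} (a : Γ) (h : S.subgroup ≤ MulAut.conj a • T.subgroup)
    (x : Γ) : toMap (homMk a h) (x : Γ ⧸ S.subgroup) = ((x * a : Γ) : Γ ⧸ T.subgroup) := rfl

lemma homMk_eq_homMk_iff {S T : OrbitCat p Γ} {a b : Γ}
    (ha : S.subgroup ≤ MulAut.conj a • T.subgroup)
    (hb : S.subgroup ≤ MulAut.conj b • T.subgroup) :
    homMk a ha = homMk b hb ↔ a⁻¹ * b ∈ T.subgroup := by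
  rw [← QuotientGroup.eq]
  constructor
  · intro h
    have := congrArg (fun f => toMap f ((1 : Γ) : Γ ⧸ S.subgroup)) h
    simpa [toMap_homMk] using this
  · intro h
    apply hom_ext_one
    simpa [toMap_homMk] using h

lemma homMk_rep {S T : OrbitCat p Γ} (f : S ⟶ T) : homMk (rep f) (subgroup_le_conj_rep f) = f := by
  apply hom_ext_one
  rw [toMap_homMk, toMap_mk]

lemma exists_eq_homMk {S T : OrbitCat p Γ} (f : S ⟶ T) :
    ∃ (a : Γ) (ha : S.subgroup ≤ MulAut.conj a • T.subgroup), f = homMk a ha :=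
  ⟨_, _, (homMk_rep f).symm⟩

lemma inv_rep_homMk_mul_mem {S T : OrbitCat p Γ} (a : Γ)
    (h : S.subgroup ≤ MulAut.conj a • T.subgroup) : (rep (homMk a h))⁻¹ * a ∈ T.subgroup := by
  rw [← homMk_eq_homMk_iff (subgroup_le_conj_rep (homMk a h)) h, homMk_rep]

lemma le_conj_mul {S T U : OrbitCat p Γ} {a b : Γ}
    (ha : S.subgroup ≤ MulAut.conj a • T.subgroup)
    (hb : T.subgroup ≤ MulAut.conj b • U.subgroup) :
    S.subgroup ≤ MulAut.conj (a * b) • U.subgroup := by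
  rw [map_mul, mul_smul]
  exact ha.trans (Subgroup.pointwise_smul_le_pointwise_smul_iff.2 hb)

lemma homMk_comp {S T U : OrbitCat p Γ} {a b : Γ}
    (ha : S.subgroup ≤ MulAut.conj a • T.subgroup)
    (hb : T.subgroup ≤ MulAut.conj b • U.subgroup) :
    homMk a ha ≫ homMk b hb = homMk (a * b) (le_conj_mul ha hb) := by
  apply hom_ext_one
  rw [toMap_comp, toMap_homMk, toMap_homMk, toMap_homMk, mul_assoc]

lemma le_conj_one {S T : OrbitCat p Γ} (h : S.subgroup ≤ T.subgroup) :
    S.subgroup ≤ MulAut.conj (1 : Γ) • T.subgroup := by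
  rwa [map_one, one_smul]

lemma homMk_of_mem {S : OrbitCat p Γ} {a : Γ} (ha : a ∈ S.subgroup) :
    homMk a (conj_smul_of_mem ha).ge = 𝟙 S := by
  apply hom_ext_one
  rw [toMap_homMk, one_mul]
  change _ = ((1 : Γ) : Γ ⧸ S.subgroup)
  rw [eq_comm, QuotientGroup.eq]
  simpa using ha

instance [Finite Γ] : Finite (OrbitCat p Γ) :=
  Finite.of_injective OrbitCat.subgroup fun ⟨_, _⟩ ⟨_, _⟩ h => by
    cases h
    rfl

instance [Finite Γ] (S T : OrbitCat p Γ) : Finite (S ⟶ T) :=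
  Finite.of_injective rep fun f g h => by
    apply hom_ext_one
    rw [toMap_mk, toMap_mk, h]

end OrbitCat

end Orbits

section Supported

variable {Γ : Type u} [Group Γ] {Y : Type u} [MulAction Γ Y]

variable (Γ Y) in
/-- A choice of a subset of the `Γ`-set `Y` for each subgroup of `Γ`, compatible with conjugation
and convex with respect to inclusion. It is the support of the functions in
`supportedFunctor`. -/
structure OrbitSupport where
  /-- The points allowed at the subgroup `P`. -/
  points : Subgroup Γ → Set Y
  smul_mem' : ∀ (g : Γ) (P : Subgroup Γ) (y : Y), y ∈ points P →
    g • y ∈ points (MulAut.conj g • P)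
  convex : ∀ {R Q P : Subgroup Γ} {y : Y}, R ≤ Q → Q ≤ P → y ∈ points R → y ∈ points P →
    y ∈ points Q

namespace OrbitSupport

variable (W : OrbitSupport Γ Y)

lemma smul_mem_iff (g : Γ) (P : Subgroup Γ) (y : Y) :
    g • y ∈ W.points (MulAut.conj g • P) ↔ y ∈ W.points P := by
  refine ⟨fun h => ?_, W.smul_mem' g P y⟩
  have := W.smul_mem' g⁻¹ _ _ h
  rwa [inv_smul_smul, ← mul_smul, ← map_mul, inv_mul_cancel, map_one, one_smul] at this

lemma inv_smul_mem_iff (g : Γ) (P : Subgroup Γ) (y : Y) :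
    g⁻¹ • y ∈ W.points P ↔ y ∈ W.points (MulAut.conj g • P) := by
  rw [← W.smul_mem_iff g, smul_inv_smul]

lemma smul_mem_iff_of_mem {g : Γ} {P : Subgroup Γ} (hg : g ∈ P) (y : Y) :
    g • y ∈ W.points P ↔ y ∈ W.points P := by
  have := W.smul_mem_iff g P y
  rwa [conj_smul_of_mem hg] at this

end OrbitSupport

variable (k : Type) [CommRing k] (V : Type) [AddCommGroup V] [Module k V]

/-- The `P`-invariant functions on `Y` which vanish outside of `W.points P`. -/
def supportedValue (W : OrbitSupport Γ Y) (P : Subgroup Γ) : Submodule k (Y → V) where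
  carrier := {φ | (∀ g ∈ P, ∀ y, φ (g • y) = φ y) ∧ ∀ y, y ∉ W.points P → φ y = 0}
  add_mem' ha hb := ⟨fun g hg y => by simp [ha.1 g hg y, hb.1 g hg y],
    fun y hy => by simp [ha.2 y hy, hb.2 y hy]⟩
  zero_mem' := ⟨fun _ _ _ => rfl, fun _ _ => rfl⟩
  smul_mem' c φ hφ := ⟨fun g hg y => by simp [hφ.1 g hg y], fun y hy => by simp [hφ.2 y hy]⟩

variable {k V} {p : ℕ}

lemma supportedValue_eq_of_mem {W : OrbitSupport Γ Y} {P : Subgroup Γ}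
    (φ : supportedValue k V W P) {a b : Γ} (h : a⁻¹ * b ∈ P) (y : Y) :
    φ.1 (a⁻¹ • y) = φ.1 (b⁻¹ • y) := by
  rw [← φ.2.1 _ h (b⁻¹ • y), smul_smul]
  simp

open Classical in
/-- The map induced by the right multiplication by `a`: translation of functions, followed by the
restriction to the new support. -/
def supportedMap (W : OrbitSupport Γ Y) {P Q : Subgroup Γ} (a : Γ)
    (h : P ≤ MulAut.conj a • Q) : supportedValue k V W Q →ₗ[k] supportedValue k V W P where
  toFun φ := ⟨fun y => if y ∈ W.points P then φ.1 (a⁻¹ • y) else 0, fun g hg y => by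
    have h1 := h hg
    rw [mem_conj_smul] at h1
    simp only [W.smul_mem_iff_of_mem hg]
    rw [← φ.2.1 _ h1 (a⁻¹ • y), smul_smul, smul_smul, mul_assoc, mul_assoc, mul_inv_cancel,
      mul_one], fun y hy => if_neg hy⟩
  map_add' φ ψ := by
    ext y
    by_cases hy : y ∈ W.points P <;> simp [hy]
  map_smul' c φ := by
    ext y
    by_cases hy : y ∈ W.points P <;> simp [hy]

lemma supportedMap_apply_of_mem {W : OrbitSupport Γ Y} {P Q : Subgroup Γ} {a : Γ}
    (h : P ≤ MulAut.conj a • Q) (φ : supportedValue k V W Q) {y : Y} (hy : y ∈ W.points P) :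
    (supportedMap W a h φ).1 y = φ.1 (a⁻¹ • y) := if_pos hy

lemma supportedMap_congr {W : OrbitSupport Γ Y} {P Q : Subgroup Γ} {a b : Γ}
    (ha : P ≤ MulAut.conj a • Q) (hb : P ≤ MulAut.conj b • Q) (hab : a⁻¹ * b ∈ Q) :
    supportedMap (k := k) (V := V) W a ha = supportedMap W b hb := by
  ext φ y
  by_cases hy : y ∈ W.points P
  · rw [supportedMap_apply_of_mem _ _ hy, supportedMap_apply_of_mem _ _ hy,
      supportedValue_eq_of_mem φ hab]
  · rw [(supportedMap W a ha φ).2.2 y hy, (supportedMap W b hb φ).2.2 y hy]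

lemma supportedMap_supportedMap {W : OrbitSupport Γ Y} {P Q R : Subgroup Γ} {a b : Γ}
    (ha : P ≤ MulAut.conj a • Q) (hb : Q ≤ MulAut.conj b • R)
    (hab : P ≤ MulAut.conj (a * b) • R) (φ : supportedValue k V W R) :
    supportedMap W a ha (supportedMap W b hb φ) = supportedMap W (a * b) hab φ := by
  ext y
  by_cases hy : y ∈ W.points P
  · rw [supportedMap_apply_of_mem _ _ hy, supportedMap_apply_of_mem _ _ hy, mul_inv_rev, mul_smul]
    by_cases hy' : a⁻¹ • y ∈ W.points Q
    · rw [supportedMap_apply_of_mem _ _ hy']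
    · rw [(supportedMap W b hb φ).2.2 _ hy', φ.2.2]
      contrapose! hy'
      rw [W.inv_smul_mem_iff] at hy' ⊢
      rw [W.inv_smul_mem_iff, ← mul_smul, ← map_mul] at hy'
      refine W.convex ha ?_ hy hy'
      rw [map_mul, mul_smul]
      exact Subgroup.pointwise_smul_le_pointwise_smul_iff.2 hb
  · rw [(supportedMap W _ _ _).2.2 y hy, (supportedMap W _ _ _).2.2 y hy]

variable (k V p) in
/-- The functor of invariant functions on `Y` with prescribed support. -/
def supportedFunctor (W : OrbitSupport Γ Y) : (OrbitCat p Γ)ᵒᵖ ⥤ ModuleCat.{u} k where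
  obj S := ModuleCat.of k (supportedValue k V W S.unop.subgroup)
  map f := ModuleCat.ofHom (supportedMap W _ (OrbitCat.subgroup_le_conj_rep f.unop))
  map_id S := by
    refine ModuleCat.hom_ext (LinearMap.ext fun φ => Subtype.ext (funext fun y => ?_))
    change (supportedMap W _ (OrbitCat.subgroup_le_conj_rep (𝟙 S.unop)) φ).1 y = φ.1 y
    have h1 : (OrbitCat.rep (𝟙 S.unop))⁻¹ * 1 ∈ S.unop.subgroup := by
      rw [← QuotientGroup.eq, OrbitCat.mk_rep]
      rfl
    rw [supportedMap_congr _ (by simp) h1]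
    by_cases hy : y ∈ W.points S.unop.subgroup
    · rw [supportedMap_apply_of_mem _ _ hy, inv_one, one_smul]
    · rw [(supportedMap W _ _ _).2.2 y hy, φ.2.2 y hy]
  map_comp {S T U} f g := by
    refine ModuleCat.hom_ext (LinearMap.ext fun φ => ?_)
    change supportedMap W _ (OrbitCat.subgroup_le_conj_rep _) φ =
      supportedMap W _ (OrbitCat.subgroup_le_conj_rep _)
        (supportedMap W _ (OrbitCat.subgroup_le_conj_rep _) φ)
    have hle := OrbitCat.le_conj_mul (OrbitCat.subgroup_le_conj_rep g.unop)
      (OrbitCat.subgroup_le_conj_rep f.unop)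
    rw [supportedMap_supportedMap _ _ hle]
    rw [supportedMap_congr _ hle]
    have h := OrbitCat.homMk_comp (OrbitCat.subgroup_le_conj_rep g.unop)
      (OrbitCat.subgroup_le_conj_rep f.unop)
    rw [OrbitCat.homMk_rep, OrbitCat.homMk_rep] at h
    rw [unop_comp, ← OrbitCat.homMk_eq_homMk_iff (OrbitCat.subgroup_le_conj_rep _) hle,
      OrbitCat.homMk_rep, h]

lemma supportedFunctor_map_homMk (W : OrbitSupport Γ Y) {S T : OrbitCat p Γ} {a : Γ}
    (h : S.subgroup ≤ MulAut.conj a • T.subgroup) (φ : supportedValue k V W T.subgroup) :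
    (supportedFunctor k V p W).map (OrbitCat.homMk a h).op φ = supportedMap W a h φ := by
  change supportedMap W _ (OrbitCat.subgroup_le_conj_rep (OrbitCat.homMk a h)) φ = _
  rw [supportedMap_congr _ h (OrbitCat.inv_rep_homMk_mul_mem a h)]

instance [Finite Y] [IsNoetherianRing k] [Module.Finite k V] (W : OrbitSupport Γ Y)
    (S : (OrbitCat p Γ)ᵒᵖ) : Module.Finite k ((supportedFunctor k V p W).obj S) :=
  inferInstanceAs (Module.Finite k (supportedValue k V W S.unop.subgroup))

/-- Natural families of linear maps between the values of two such functors. -/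
def supportedHom {Z : Type u} [MulAction Γ Z] {V' : Type} [AddCommGroup V'] [Module k V']
    {W : OrbitSupport Γ Y} {W' : OrbitSupport Γ Z}
    (α : ∀ S : OrbitCat p Γ,
      supportedValue k V W S.subgroup →ₗ[k] supportedValue k V' W' S.subgroup)
    (hα : ∀ {S T : OrbitCat p Γ} (a : Γ) (h : S.subgroup ≤ MulAut.conj a • T.subgroup)
      (φ : supportedValue k V W T.subgroup),
      α S (supportedMap W a h φ) = supportedMap W' a h (α T φ)) :
    supportedFunctor k V p W ⟶ supportedFunctor k V' p W' where
  app S := ModuleCat.ofHom (α S.unop)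
  naturality _ _ f := ModuleCat.hom_ext (LinearMap.ext fun φ =>
    hα _ (OrbitCat.subgroup_le_conj_rep f.unop) φ)

end Supported

/-! ### Exact sequences and isomorphisms of functors of supported functions -/

section Exactness

lemma shortExact_of_app {C : Type u} [SmallCategory C] {k : Type} [CommRing k]
    {S : ShortComplex (Cᵒᵖ ⥤ ModuleCat.{u} k)} (h₁ : ∀ c, Function.Injective (S.f.app c))
    (h₂ : ∀ c (x : S.X₂.obj c), S.g.app c x = 0 → ∃ y, S.f.app c y = x)
    (h₃ : ∀ c, Function.Surjective (S.g.app c)) : S.ShortExact where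
  exact := by
    rw [ShortComplex.exact_iff_isZero_homology]
    refine Functor.isZero _ fun c => ?_
    refine IsZero.of_iso ?_ (S.mapHomologyIso ((evaluation _ _).obj c)).symm
    rw [← ShortComplex.exact_iff_isZero_homology, ShortComplex.moduleCat_exact_iff]
    exact h₂ c
  mono_f := (NatTrans.mono_iff_mono_app _).2 fun c => (ModuleCat.mono_iff_injective _).2 (h₁ c)
  epi_g := (NatTrans.epi_iff_epi_app _).2 fun c => (ModuleCat.epi_iff_surjective _).2 (h₃ c)

variable {Γ : Type u} [Group Γ] {Y : Type u} [MulAction Γ Y]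
  {k : Type} [CommRing k] {V : Type} [AddCommGroup V] [Module k V] (p : ℕ)

/-- If the support `W` is the disjoint union of `W₁` and `W₂`, and `W₁` is closed in `W` under the
passage to smaller subgroups, then the functions with support in `W₁` form a subfunctor, with
quotient the functions with support in `W₂`. -/
lemma exists_shortExact_supportedFunctor (k : Type) [CommRing k] (V : Type) [AddCommGroup V]
    [Module k V] {W W₁ W₂ : OrbitSupport Γ Y}
    (hW : ∀ P, W.points P = W₁.points P ∪ W₂.points P)
    (hd : ∀ P, Disjoint (W₁.points P) (W₂.points P))
    (hs : ∀ {Q P : Subgroup Γ} {y : Y}, IsPGroup p P → Q ≤ P → y ∈ W₁.points P →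
      y ∈ W.points Q → y ∈ W₁.points Q) :
    ∃ (f : supportedFunctor k V p W₁ ⟶ supportedFunctor k V p W)
      (g : supportedFunctor k V p W ⟶ supportedFunctor k V p W₂) (w : f ≫ g = 0),
      (ShortComplex.mk f g w).ShortExact := by
  classical
  have h₁ : ∀ {P y}, y ∈ W₁.points P → y ∈ W.points P := fun h => by
    rw [hW]
    exact Or.inl h
  have h₂ : ∀ {P y}, y ∈ W₂.points P → y ∈ W.points P := fun h => by
    rw [hW]
    exact Or.inr h
  have h₁₂ : ∀ {P y}, y ∈ W₁.points P → y ∉ W₂.points P := fun {P y} h h' =>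
    Set.disjoint_left.1 (hd P) h h'
  have hs' : ∀ {S T : OrbitCat p Γ} {a : Γ} (_ : S.subgroup ≤ MulAut.conj a • T.subgroup) {y : Y},
      a⁻¹ • y ∈ W₁.points T.subgroup → y ∈ W.points S.subgroup → y ∈ W₁.points S.subgroup := by
    intro S T a h y hy hy'
    rw [OrbitSupport.inv_smul_mem_iff] at hy
    exact hs (T.isPGroup.map _) h hy hy'
  let f : supportedFunctor k V p W₁ ⟶ supportedFunctor k V p W := supportedHom
    (fun S =>
      { toFun := fun φ => ⟨φ.1, φ.2.1, fun y hy => φ.2.2 y fun h => hy (h₁ h)⟩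
        map_add' := fun _ _ => rfl
        map_smul' := fun _ _ => rfl })
    (fun {S T} a h φ => by
      ext y
      change (supportedMap W₁ a h φ).1 y = (supportedMap W a h ⟨φ.1, _⟩).1 y
      by_cases hy : y ∈ W.points S.subgroup
      · rw [supportedMap_apply_of_mem _ _ hy]
        by_cases hy' : y ∈ W₁.points S.subgroup
        · rw [supportedMap_apply_of_mem _ _ hy']
        · rw [(supportedMap W₁ a h φ).2.2 y hy']
          by_contra hne
          exact hy' (hs' h (by_contra fun hh => hne (φ.2.2 _ hh).symm) hy)
      · rw [(supportedMap W₁ a h φ).2.2 y fun hh => hy (h₁ hh), (supportedMap W a h _).2.2 y hy])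
  let g : supportedFunctor k V p W ⟶ supportedFunctor k V p W₂ := supportedHom
    (fun S =>
      { toFun := fun φ => ⟨fun y => if y ∈ W₂.points S.subgroup then φ.1 y else 0,
          fun g hg y => by simp only [W₂.smul_mem_iff_of_mem hg, φ.2.1 g hg], fun y hy => if_neg hy⟩
        map_add' := fun φ ψ => by
          ext y
          by_cases hy : y ∈ W₂.points S.subgroup <;> simp [hy]
        map_smul' := fun c φ => by
          ext y
          by_cases hy : y ∈ W₂.points S.subgroup <;> simp [hy] })
    (fun {S T} a h φ => by
      ext y
      by_cases hy : y ∈ W₂.points S.subgroup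
      · change (if _ then _ else _) = _
        rw [if_pos hy, supportedMap_apply_of_mem _ _ hy, supportedMap_apply_of_mem _ _ (h₂ hy)]
        change _ = if _ then _ else _
        split_ifs with hy'
        · rfl
        · refine φ.2.2 _ fun hh => ?_
          rw [hW] at hh
          rcases hh with hh | hh
          · exact h₁₂ (hs' h hh (h₂ hy)) hy
          · exact hy' hh
      · change (if _ then _ else _) = _
        rw [if_neg hy, (supportedMap W₂ a h _).2.2 y hy])
  refine ⟨f, g, ?_, shortExact_of_app ?_ ?_ ?_⟩
  · ext S : 2
    refine ModuleCat.hom_ext (LinearMap.ext fun φ => Subtype.ext (funext fun y => ?_))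
    change (if _ then φ.1 y else 0) = 0
    split_ifs with hy
    · exact φ.2.2 y fun hh => h₁₂ hh hy
    · rfl
  · intro S φ ψ h
    exact Subtype.ext (congrArg Subtype.val h :)
  · intro S φ h
    refine ⟨⟨φ.1, φ.2.1, fun y hy => ?_⟩, rfl⟩
    by_contra hne
    have hy' : y ∈ W.points S.unop.subgroup := by_contra fun hh => hne (φ.2.2 _ hh)
    rw [hW] at hy'
    have := congrFun (congrArg Subtype.val h) y
    change (if _ then φ.1 y else 0) = 0 at this
    rw [if_pos (hy'.resolve_left hy)] at this
    exact hne this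
  · intro S φ
    refine ⟨⟨φ.1, φ.2.1, fun y hy => φ.2.2 y fun hh => hy (h₂ hh)⟩, ?_⟩
    refine Subtype.ext (funext fun y => ?_)
    change (if _ then φ.1 y else 0) = φ.1 y
    split_ifs with hy
    · rfl
    · exact (φ.2.2 y hy).symm

/-- The functors attached to supports on different `Γ`-sets agree if there is an equivariant map
between them which identifies the orbits of the supports. -/
lemma exists_iso_supportedFunctor (k : Type) [CommRing k] (V : Type) [AddCommGroup V]
    [Module k V] {Z : Type u} [MulAction Γ Z] (W : OrbitSupport Γ Y) (W' : OrbitSupport Γ Z)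
    (π : Z → Y) (hπ : ∀ (g : Γ) (z : Z), π (g • z) = g • π z)
    (h₁ : ∀ {P z}, z ∈ W'.points P → π z ∈ W.points P)
    (h₂ : ∀ {P y}, y ∈ W.points P → ∃ z ∈ W'.points P, π z = y)
    (h₃ : ∀ {P z z'}, z ∈ W'.points P → z' ∈ W'.points P → π z = π z' → ∃ g ∈ P, g • z = z')
    (h₄ : ∀ {Q P z}, Q ≤ P → z ∈ W'.points Q → π z ∈ W.points P → z ∈ W'.points P) :
    Nonempty (supportedFunctor k V p W ≅ supportedFunctor k V p W') := by
  classical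
  let f : supportedFunctor k V p W ⟶ supportedFunctor k V p W' := supportedHom
    (fun S =>
      { toFun := fun φ => ⟨fun z => if z ∈ W'.points S.subgroup then φ.1 (π z) else 0,
          fun g hg y => by simp only [W'.smul_mem_iff_of_mem hg, hπ, φ.2.1 g hg],
          fun y hy => if_neg hy⟩
        map_add' := fun φ ψ => by
          ext y
          by_cases hy : y ∈ W'.points S.subgroup <;> simp [hy]
        map_smul' := fun c φ => by
          ext y
          by_cases hy : y ∈ W'.points S.subgroup <;> simp [hy] })
    (fun {S T} a h φ => by
      ext z
      by_cases hz : z ∈ W'.points S.subgroup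
      · change (if _ then _ else _) = _
        rw [if_pos hz, supportedMap_apply_of_mem _ _ hz, supportedMap_apply_of_mem _ _ (h₁ hz)]
        change _ = if _ then φ.1 (π (a⁻¹ • z)) else _
        rw [hπ]
        split_ifs with hz'
        · rfl
        · refine φ.2.2 _ fun hh => hz' ?_
          rw [OrbitSupport.inv_smul_mem_iff] at hh ⊢
          exact h₄ h hz hh
      · change (if _ then _ else _) = _
        rw [if_neg hz, (supportedMap W' a h _).2.2 z hz])
  have hf : ∀ S, Function.Bijective (f.app S) := by
    intro S
    constructor
    · intro φ ψ h
      refine Subtype.ext (funext fun y => ?_)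
      by_cases hy : y ∈ W.points S.unop.subgroup
      · obtain ⟨z, hz, rfl⟩ := h₂ hy
        have := congrFun (congrArg Subtype.val h) z
        change (if _ then φ.1 (π z) else 0) = if _ then ψ.1 (π z) else 0 at this
        rwa [if_pos hz, if_pos hz] at this
      · rw [φ.2.2 y hy, ψ.2.2 y hy]
    · intro ψ
      have hex (y : Y) : ∃ v : V, (∀ z ∈ W'.points S.unop.subgroup, π z = y → v = ψ.1 z) ∧
          (y ∉ W.points S.unop.subgroup → v = 0) := by
        by_cases hy : y ∈ W.points S.unop.subgroup
        · obtain ⟨z, hz, rfl⟩ := h₂ hy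
          refine ⟨ψ.1 z, fun z' hz' h => ?_, fun h => absurd hy h⟩
          obtain ⟨g, hg, rfl⟩ := h₃ hz hz' h.symm
          exact (ψ.2.1 g hg z).symm
        · exact ⟨0, fun z hz h => absurd (h ▸ h₁ hz) hy, fun _ => rfl⟩
      choose v hv hv' using hex
      refine ⟨⟨v, fun g hg y => ?_, hv'⟩, ?_⟩
      · by_cases hy : y ∈ W.points S.unop.subgroup
        · obtain ⟨z, hz, rfl⟩ := h₂ hy
          rw [hv _ z hz rfl, hv _ (g • z) ((W'.smul_mem_iff_of_mem hg z).2 hz) (hπ g z),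
            ψ.2.1 g hg]
        · rw [hv' _ hy, hv' _ (mt (W.smul_mem_iff_of_mem hg y).1 hy)]
      · refine Subtype.ext (funext fun z => ?_)
        change (if _ then v (π z) else 0) = ψ.1 z
        split_ifs with hz
        · exact hv _ z hz rfl
        · exact (ψ.2.2 z hz).symm
  have : ∀ S, IsIso (f.app S) := fun S =>
    (ConcreteCategory.isIso_iff_bijective (f.app S)).2 (hf S)
  have := NatIso.isIso_of_isIso_app f
  exact ⟨asIso f⟩

/-- Multiplication by a non-zero element of a domain, on the functions with values in the domain. -/
lemma exists_shortExact_smul (k : Type) [CommRing k] [IsDomain k] {a : k} (ha : a ≠ 0)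
    (W : OrbitSupport Γ Y) :
    ∃ (g : supportedFunctor k k p W ⟶ supportedFunctor k (k ⧸ Ideal.span {a}) p W)
      (w : (a • 𝟙 (supportedFunctor k k p W)) ≫ g = 0), (ShortComplex.mk _ g w).ShortExact := by
  let q : k →ₗ[k] k ⧸ Ideal.span {a} := (Ideal.span {a}).mkQ
  have hq : ∀ x, q x = 0 → ∃ y, a * y = x := fun x hx => by
    have : x ∈ Ideal.span {a} := (Submodule.Quotient.mk_eq_zero _).1 hx
    obtain ⟨y, rfl⟩ := Ideal.mem_span_singleton.1 this
    exact ⟨y, rfl⟩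
  let g : supportedFunctor k k p W ⟶ supportedFunctor k (k ⧸ Ideal.span {a}) p W := supportedHom
    (fun S =>
      { toFun := fun φ => ⟨fun y => q (φ.1 y), fun g hg y => congrArg q (φ.2.1 g hg y),
          fun y hy => (congrArg q (φ.2.2 y hy)).trans (map_zero q)⟩
        map_add' := fun φ ψ => by
          ext y
          exact map_add q _ _
        map_smul' := fun c φ => by
          ext y
          exact map_smul q _ _ })
    (fun {S T} b h φ => by
      ext y
      by_cases hy : y ∈ W.points S.subgroup
      · rw [supportedMap_apply_of_mem _ _ hy]
        change q ((supportedMap W b h φ).1 y) = q _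
        rw [supportedMap_apply_of_mem _ _ hy]
      · rw [(supportedMap W b h _).2.2 y hy]
        change q ((supportedMap W b h φ).1 y) = 0
        rw [(supportedMap W b h _).2.2 y hy, map_zero])
  refine ⟨g, ?_, shortExact_of_app ?_ ?_ ?_⟩
  · ext S : 2
    refine ModuleCat.hom_ext (LinearMap.ext fun φ => Subtype.ext (funext fun y => ?_))
    change q (a * φ.1 y) = 0
    exact (Submodule.Quotient.mk_eq_zero _).2
      (Ideal.mul_mem_right _ _ (Ideal.mem_span_singleton_self a))
  · intro S φ ψ h
    refine Subtype.ext (funext fun y => ?_)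
    exact mul_left_cancel₀ ha (congrFun (congrArg Subtype.val h) y :)
  · intro S φ h
    choose ψ hψ using fun y => hq _ (congrFun (congrArg Subtype.val h) y :)
    refine ⟨⟨ψ, fun g hg y => ?_, fun y hy => ?_⟩, Subtype.ext (funext hψ)⟩
    · exact mul_left_cancel₀ ha (by rw [hψ, hψ, φ.2.1 g hg])
    · exact mul_left_cancel₀ ha (by rw [hψ, φ.2.2 y hy, mul_zero])
  · intro S φ
    -- a set-theoretic section of the quotient map which preserves `0`
    have hex : ∀ v : k ⧸ Ideal.span {a}, ∃ x, q x = v ∧ (v = 0 → x = 0) := fun v => by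
      by_cases hv : v = 0
      · exact ⟨0, by rw [hv, map_zero], fun _ => rfl⟩
      · obtain ⟨x, hx⟩ := Submodule.mkQ_surjective _ v
        exact ⟨x, hx, fun h => absurd h hv⟩
    choose σ hσ hσ' using hex
    refine ⟨⟨fun y => σ (φ.1 y), fun g hg y => congrArg σ (φ.2.1 g hg y),
      fun y hy => hσ' _ (φ.2.2 y hy)⟩, Subtype.ext (funext fun y => hσ _)⟩

end Exactness

/-! ### Transfer -/

section Transfer

/-- A sum over a set with an action of a `p`-group, of an invariant function with values in a
group of exponent `p` which vanishes at the fixed points, is zero. -/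
lemma sum_eq_zero_of_isPGroup {p : ℕ} [Fact p.Prime] {K T V : Type*} [Group K] (hK : IsPGroup p K)
    [MulAction K T] [Fintype T] [AddCommGroup V] (hV : ∀ v : V, p • v = 0) (h : T → V)
    (hinv : ∀ (g : K) (t : T), h (g • t) = h t)
    (hfix : ∀ t, t ∈ MulAction.fixedPoints K T → h t = 0) : ∑ t, h t = 0 := by
  classical
  rw [Finset.sum_comp (fun v => v) h]
  refine Finset.sum_eq_zero fun v _ => ?_
  by_cases hv : v = 0
  · rw [hv, smul_zero]
  let A : SubMulAction K T := ⟨{t | h t = v}, fun g t ht => (hinv g t).trans ht⟩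
  have hcard : p ∣ Nat.card A := by
    refine (Nat.modEq_zero_iff_dvd).1 ((hK.card_modEq_card_fixedPoints A).trans ?_)
    have : IsEmpty (MulAction.fixedPoints K A) := ⟨fun ⟨⟨t, ht⟩, hf⟩ => hv (by
      have ht' : h t = v := ht
      rw [← ht', hfix t fun g => congrArg Subtype.val (hf g)])⟩
    rw [Nat.card_of_isEmpty]
  have hc : Nat.card A = (Finset.univ.filter fun t => h t = v).card := by
    rw [← Fintype.card_subtype, ← Nat.card_eq_fintype_card]
    rfl
  obtain ⟨c, hc'⟩ := hcard
  rw [← hc, hc', mul_comm, mul_smul, hV, smul_zero]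

/-- A family of subgroups which is closed under conjugation and convex with respect to
inclusion. -/
structure ConvexFamily (Γ : Type u) [Group Γ] where
  /-- The subgroups in the family. -/
  carrier : Set (Subgroup Γ)
  conj_mem : ∀ (g : Γ) {P : Subgroup Γ}, P ∈ carrier → MulAut.conj g • P ∈ carrier
  convex : ∀ {R Q P : Subgroup Γ}, R ≤ Q → Q ≤ P → R ∈ carrier → P ∈ carrier → Q ∈ carrier

variable {Γ : Type u} [Group Γ]

namespace ConvexFamily

variable (𝒬 : ConvexFamily Γ)

lemma conj_mem_iff (g : Γ) (P : Subgroup Γ) : MulAut.conj g • P ∈ 𝒬.carrier ↔ P ∈ 𝒬.carrier := by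
  refine ⟨fun h => ?_, 𝒬.conj_mem g⟩
  have := 𝒬.conj_mem g⁻¹ h
  rwa [← mul_smul, ← map_mul, inv_mul_cancel, map_one, one_smul] at this

lemma conj_inf_stabilizer {Y : Type*} [MulAction Γ Y] (g : Γ) (P : Subgroup Γ) (y : Y) :
    MulAut.conj g • P ⊓ MulAction.stabilizer Γ (g • y) =
      MulAut.conj g • (P ⊓ MulAction.stabilizer Γ y) := by
  ext x
  rw [Subgroup.mem_inf, mem_conj_smul, mem_conj_smul, Subgroup.mem_inf,
    MulAction.mem_stabilizer_iff, MulAction.mem_stabilizer_iff, mul_smul, mul_smul, inv_smul_eq_iff]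

/-- The points of a `Γ`-set whose stabilizer in `P` belongs to the family. -/
def support (Y : Type u) [MulAction Γ Y] : OrbitSupport Γ Y where
  points P := {y | P ⊓ MulAction.stabilizer Γ y ∈ 𝒬.carrier}
  smul_mem' g P y hy := by
    change MulAut.conj g • P ⊓ _ ∈ 𝒬.carrier
    rw [conj_inf_stabilizer]
    exact 𝒬.conj_mem g hy
  convex h₁ h₂ := 𝒬.convex (inf_le_inf_right _ h₁) (inf_le_inf_right _ h₂)

variable {Y : Type u} [MulAction Γ Y] {T : Type u} [MulAction Γ T]
  {k : Type} [CommRing k] {V : Type} [AddCommGroup V] [Module k V] {p : ℕ} [Fact p.Prime]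

lemma mem_support_prod_of_fixed {P : Subgroup Γ} {t : T} {y : Y}
    (h : ∀ g ∈ P ⊓ MulAction.stabilizer Γ y, g • t = t) :
    (t, y) ∈ (𝒬.support (T × Y)).points P ↔ y ∈ (𝒬.support Y).points P := by
  have : P ⊓ MulAction.stabilizer Γ (t, y) = P ⊓ MulAction.stabilizer Γ y := by
    ext x
    simp only [Subgroup.mem_inf, MulAction.mem_stabilizer_iff, Prod.smul_mk, Prod.mk.injEq]
    exact ⟨fun hx => ⟨hx.1, hx.2.2⟩, fun hx => ⟨hx.1, h x hx, hx.2⟩⟩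
  change P ⊓ _ ∈ 𝒬.carrier ↔ P ⊓ _ ∈ 𝒬.carrier
  rw [this]

variable [Fintype T]

/-- Over coefficients of characteristic `p`, summation over `T` maps functions on `T × Y` to
functions on `Y` with the right support. -/
lemma sum_eq_zero_of_notMem_support (hV : ∀ v : V, p • v = 0) {P : Subgroup Γ} (hP : IsPGroup p P)
    (φ : supportedValue k V (𝒬.support (T × Y)) P) {y : Y} (hy : y ∉ (𝒬.support Y).points P) :
    ∑ t, φ.1 (t, y) = 0 := by
  refine sum_eq_zero_of_isPGroup (K := (P ⊓ MulAction.stabilizer Γ y : Subgroup Γ))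
    (hP.to_le inf_le_left) hV _ (fun g t => ?_) fun t ht => φ.2.2 _ fun h => hy ?_
  · rw [← φ.2.1 g.1 g.2.1 (t, y)]
    exact congrArg φ.1 (Prod.ext rfl g.2.2.symm)
  · exact (𝒬.mem_support_prod_of_fixed fun g hg => ht ⟨g, hg⟩).1 h

/-- Over coefficients of characteristic `p`, restriction commutes with summation over `T`: the
terms which are lost by restricting from `P` to `S` are permuted by the stabilizer of `y` in `S`
without fixed points. -/
lemma sum_supportedMap (hV : ∀ v : V, p • v = 0) {S P : Subgroup Γ} (hS : IsPGroup p S)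
    {a : Γ} (h : S ≤ MulAut.conj a • P) (φ : supportedValue k V (𝒬.support (T × Y)) P) {y : Y}
    (hy : y ∈ (𝒬.support Y).points S) :
    ∑ t, (supportedMap _ a h φ).1 (t, y) = ∑ t, φ.1 (t, a⁻¹ • y) := by
  classical
  rw [← Equiv.sum_comp (MulAction.toPerm a⁻¹ : Equiv.Perm T) fun t => φ.1 (t, a⁻¹ • y),
    ← sub_eq_zero, ← Finset.sum_sub_distrib]
  refine sum_eq_zero_of_isPGroup (K := (S ⊓ MulAction.stabilizer Γ y : Subgroup Γ))
    (hS.to_le inf_le_left) hV _ (fun g t => ?_) fun t ht => ?_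
  · have h1 : (g • t, y) = g.1 • (t, y) := Prod.ext rfl g.2.2.symm
    have h2 : ((a⁻¹ • (g • t), a⁻¹ • y) : T × Y) = (a⁻¹ * g * a) • (a⁻¹ • t, a⁻¹ • y) := by
      rw [Prod.smul_mk, smul_smul, smul_smul, mul_inv_cancel_right, mul_smul, mul_smul]
      exact Prod.ext rfl (by rw [g.2.2])
    have h3 := h g.2.1
    rw [mem_conj_smul] at h3
    change _ - φ.1 (a⁻¹ • (g • t), a⁻¹ • y) = _ - φ.1 (a⁻¹ • t, a⁻¹ • y)
    rw [h1, (supportedMap _ a h φ).2.1 g.1 g.2.1, h2, φ.2.1 _ h3]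
  · rw [supportedMap_apply_of_mem]
    · exact sub_self _
    · exact (𝒬.mem_support_prod_of_fixed fun g hg => ht ⟨g, hg⟩).2 hy

/-- If the cardinality of `T` is prime to `p`, then a function on `Y` with coefficients of
characteristic `p` is recovered from its pull-back to `T × Y`. -/
lemma sum_pullback (hV : ∀ v : V, p • v = 0) {P : Subgroup Γ} (hP : IsPGroup p P)
    (φ : supportedValue k V (𝒬.support Y) P) (y : Y)
    [DecidablePred fun z : T × Y => z ∈ (𝒬.support (T × Y)).points P] :
    ∑ t : T, (if (t, y) ∈ (𝒬.support (T × Y)).points P then φ.1 y else 0) =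
      Fintype.card T • φ.1 y := by
  by_cases hy : y ∈ (𝒬.support Y).points P
  · rw [← Finset.card_univ, ← Finset.sum_const, ← sub_eq_zero, ← Finset.sum_sub_distrib]
    refine sum_eq_zero_of_isPGroup (K := (P ⊓ MulAction.stabilizer Γ y : Subgroup Γ))
      (hP.to_le inf_le_left) hV _ (fun g t => ?_) fun t ht => ?_
    · have h1 : (g • t, y) = g.1 • (t, y) := Prod.ext rfl g.2.2.symm
      simp only [h1, (𝒬.support (T × Y)).smul_mem_iff_of_mem g.2.1]
    · rw [if_pos ((𝒬.mem_support_prod_of_fixed fun g hg => ht ⟨g, hg⟩).2 hy), sub_self]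
  · simp [φ.2.2 y hy]

/-- The transfer: over coefficients of characteristic `p`, the functions on `Y` are a retract of
those on `T × Y` if the cardinality of `T` is prime to `p`. -/
lemma exists_retract (k : Type) [CommRing k] (V : Type) [AddCommGroup V] [Module k V] (Y T : Type u)
    [MulAction Γ Y] [MulAction Γ T] [Fintype T]
    (hV : ∀ v : V, p • v = 0) (hT : ¬ p ∣ Fintype.card T) :
    ∃ (s : supportedFunctor k V p (𝒬.support Y) ⟶ supportedFunctor k V p (𝒬.support (T × Y)))
      (r : supportedFunctor k V p (𝒬.support (T × Y)) ⟶ supportedFunctor k V p (𝒬.support Y)),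
      s ≫ r = 𝟙 _ := by
  classical
  have hp : p.Prime := Fact.out
  obtain ⟨m, -, hm⟩ := Nat.exists_mul_mod_eq_one_of_coprime
    ((Nat.Prime.coprime_iff_not_dvd hp).2 hT).symm hp.one_lt
  have hm' : ∀ v : V, m • Fintype.card T • v = v := fun v => by
    rw [smul_smul, mul_comm, ← Nat.div_add_mod (Fintype.card T * m) p, hm, add_smul, mul_comm,
      mul_smul, hV, smul_zero, one_smul, zero_add]
  have hle : ∀ {P : Subgroup Γ} {t : T} {y : Y},
      P ⊓ MulAction.stabilizer Γ (t, y) ≤ P ⊓ MulAction.stabilizer Γ y := by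
    intro P t y x hx
    exact ⟨hx.1, congrArg Prod.snd (hx.2 : x • (t, y) = (t, y))⟩
  let s : supportedFunctor k V p (𝒬.support Y) ⟶ supportedFunctor k V p (𝒬.support (T × Y)) :=
    supportedHom
      (fun S =>
        { toFun := fun φ => ⟨fun z => if z ∈ (𝒬.support (T × Y)).points S.subgroup then φ.1 z.2
              else 0, fun g hg z => by
              simp only [(𝒬.support (T × Y)).smul_mem_iff_of_mem hg, Prod.smul_snd, φ.2.1 g hg],
            fun z hz => if_neg hz⟩
          map_add' := fun φ ψ => by
            ext z
            by_cases hz : z ∈ (𝒬.support (T × Y)).points S.subgroup <;> simp [hz]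
          map_smul' := fun c φ => by
            ext z
            by_cases hz : z ∈ (𝒬.support (T × Y)).points S.subgroup <;> simp [hz] })
      (fun {S P} a h φ => by
        ext z
        obtain ⟨t, y⟩ := z
        by_cases hz : (t, y) ∈ (𝒬.support (T × Y)).points S.subgroup
        · change (if _ then (supportedMap _ a h φ).1 y else _) = _
          rw [if_pos hz, supportedMap_apply_of_mem _ _ hz]
          change _ = if (a⁻¹ • t, a⁻¹ • y) ∈ _ then φ.1 (a⁻¹ • y) else 0
          by_cases hy : a⁻¹ • y ∈ (𝒬.support Y).points P.subgroup
          · have hy' := hy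
            rw [OrbitSupport.inv_smul_mem_iff] at hy'
            have hz' : (a⁻¹ • t, a⁻¹ • y) ∈ (𝒬.support (T × Y)).points P.subgroup := by
              refine ((𝒬.support (T × Y)).inv_smul_mem_iff a _ (t, y)).2 ?_
              exact 𝒬.convex (inf_le_inf_right _ h) hle hz hy'
            rw [if_pos hz', supportedMap_apply_of_mem]
            exact 𝒬.convex hle (inf_le_inf_right _ h) hz hy'
          · rw [φ.2.2 _ hy, ite_self]
            by_cases hy' : y ∈ (𝒬.support Y).points S.subgroup
            · rw [supportedMap_apply_of_mem _ _ hy', φ.2.2 _ hy]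
            · exact (supportedMap _ a h φ).2.2 _ hy'
        · rw [(supportedMap _ a h _).2.2 _ hz]
          exact if_neg hz)
  let r : supportedFunctor k V p (𝒬.support (T × Y)) ⟶ supportedFunctor k V p (𝒬.support Y) :=
    supportedHom
      (fun S =>
        { toFun := fun φ => ⟨fun y => m • ∑ t, φ.1 (t, y), fun g hg y => by
              refine congrArg (m • ·) ?_
              rw [← Equiv.sum_comp (MulAction.toPerm g : Equiv.Perm T) fun t => φ.1 (t, g • y)]
              exact Finset.sum_congr rfl fun t _ => φ.2.1 g hg (t, y), fun y hy => by
              change m • _ = _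
              rw [𝒬.sum_eq_zero_of_notMem_support hV S.isPGroup φ hy, smul_zero]⟩
          map_add' := fun φ ψ => by
            ext y
            simp [Finset.sum_add_distrib]
          map_smul' := fun c φ => by
            ext y
            simp [Finset.smul_sum, smul_comm m c] })
      (fun {S P} a h φ => by
        ext y
        by_cases hy : y ∈ (𝒬.support Y).points S.subgroup
        · rw [supportedMap_apply_of_mem _ _ hy]
          change m • _ = m • _
          rw [𝒬.sum_supportedMap hV S.isPGroup h φ hy]
        · rw [(supportedMap _ a h _).2.2 y hy]
          change m • _ = _
          rw [𝒬.sum_eq_zero_of_notMem_support hV S.isPGroup _ hy, smul_zero])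
  refine ⟨s, r, ?_⟩
  ext S : 2
  refine ModuleCat.hom_ext (LinearMap.ext fun φ => Subtype.ext (funext fun y => ?_))
  change m • ∑ t, (if (t, y) ∈ (𝒬.support (T × Y)).points S.unop.subgroup then φ.1 y else 0) = φ.1 y
  rw [𝒬.sum_pullback hV S.unop.isPGroup φ y, hm']

end ConvexFamily

end Transfer

/-! ### Shapiro's lemma -/

section Induction

variable {p : ℕ} {Γ : Type u} [Group Γ] (H : Subgroup Γ)

lemma map_subtype_le_conj {R R' : Subgroup H} {h : H} (hR : R ≤ MulAut.conj h • R') :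
    R.map H.subtype ≤ MulAut.conj (h : Γ) • R'.map H.subtype := by
  rintro _ ⟨x, hx, rfl⟩
  rw [mem_conj_smul]
  exact ⟨h⁻¹ * x * h, (mem_conj_smul _ _ _).1 (hR hx), rfl⟩

lemma subgroupOf_map_subtype (R : Subgroup H) : (R.map H.subtype).subgroupOf H = R :=
  Subgroup.comap_map_eq_self_of_injective H.subtype_injective R

namespace OrbitCat

/-- The orbit `Γ ×_H (H ⧸ R) = Γ ⧸ R`. -/
def inductionObj (R : OrbitCat p H) : OrbitCat p Γ :=
  ⟨R.subgroup.map H.subtype, R.isPGroup.map _⟩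

lemma inductionObj_le_conj {R R' : OrbitCat p H} {h : H}
    (hR : R.subgroup ≤ MulAut.conj h • R'.subgroup) :
    (inductionObj H R).subgroup ≤ MulAut.conj (h : Γ) • (inductionObj H R').subgroup :=
  map_subtype_le_conj H hR

lemma coe_mem_inductionObj {R : OrbitCat p H} {h : H} (hh : h ∈ R.subgroup) :
    (h : Γ) ∈ (inductionObj H R).subgroup := Subgroup.mem_map_of_mem H.subtype hh

/-- Induction of orbits from the subgroup `H` to `Γ`. -/
def inductionFunctor : OrbitCat p H ⥤ OrbitCat p Γ where
  obj R := inductionObj H R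
  map {R R'} f := homMk ((rep f : H) : Γ)
    (inductionObj_le_conj H (R := R) (R' := R') (subgroup_le_conj_rep f))
  map_id R := by
    have h : rep (𝟙 R) ∈ R.subgroup := by
      have : ((1 : H) : H ⧸ R.subgroup) = (rep (𝟙 R) : H) := (mk_rep (𝟙 R)).symm
      rw [QuotientGroup.eq] at this
      simpa using this
    exact homMk_of_mem (coe_mem_inductionObj H h)
  map_comp {R S T} f g := by
    rw [homMk_comp, homMk_eq_homMk_iff]
    have h := homMk_comp (subgroup_le_conj_rep f) (subgroup_le_conj_rep g)
    rw [homMk_rep, homMk_rep, ← homMk_rep (f ≫ g), homMk_eq_homMk_iff] at h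
    exact coe_mem_inductionObj H h

lemma induction_map_homMk {R R' : OrbitCat p H} {h : H}
    (hR : R.subgroup ≤ MulAut.conj h • R'.subgroup) :
    (inductionFunctor H).map (homMk h hR) =
      homMk (S := (inductionFunctor H).obj R) (T := (inductionFunctor H).obj R') (h : Γ)
        (inductionObj_le_conj H hR) :=
  (homMk_eq_homMk_iff (inductionObj_le_conj H (subgroup_le_conj_rep _)) _).2
    (coe_mem_inductionObj H (inv_rep_homMk_mul_mem h hR))

lemma induction_map_comp_eq_iff {R R' : OrbitCat p H} {P : OrbitCat p Γ} {h : H} {a b : Γ}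
    (hR : R.subgroup ≤ MulAut.conj h • R'.subgroup)
    (ha : ((inductionFunctor H).obj R').subgroup ≤ MulAut.conj a • P.subgroup)
    (hb : ((inductionFunctor H).obj R).subgroup ≤ MulAut.conj b • P.subgroup) :
    (inductionFunctor H).map (homMk h hR) ≫ homMk a ha = homMk b hb ↔
      ((h : Γ) * a)⁻¹ * b ∈ P.subgroup := by
  have e : (inductionFunctor H).map (homMk h hR) ≫ homMk a ha =
      homMk ((h : Γ) * a) (le_conj_mul (inductionObj_le_conj H hR) ha) := by
    rw [induction_map_homMk]
    exact homMk_comp _ _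
  rw [e]
  exact homMk_eq_homMk_iff _ _

/-- The stabilizer in `H` of the point `a P` of `Γ ⧸ P`, as an object of the orbit category
of `H`. -/
def pointStabilizer (P : OrbitCat p Γ) (a : Γ) : OrbitCat p H :=
  ⟨(MulAut.conj a • P.subgroup).subgroupOf H, (P.isPGroup.map _).comap_subtype⟩

lemma map_pointStabilizer_le (P : OrbitCat p Γ) (a : Γ) :
    ((inductionFunctor H).obj (pointStabilizer H P a)).subgroup ≤ MulAut.conj a • P.subgroup :=
  Subgroup.map_le_iff_le_comap.2 le_rfl

/-- The map of orbits sending the coset of `1` to `a P`. -/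
def fromPointStabilizer (P : OrbitCat p Γ) (a : Γ) :
    (inductionFunctor H).obj (pointStabilizer H P a) ⟶ P :=
  homMk a (map_pointStabilizer_le H P a)

lemma mem_pointStabilizer {P : OrbitCat p Γ} {a : Γ} {h : H} :
    h ∈ (pointStabilizer H P a).subgroup ↔ a⁻¹ * h * a ∈ P.subgroup :=
  mem_conj_smul a (h : Γ) P.subgroup

/-- As an `H`-set, the orbit `Γ ⧸ P` is the disjoint union of its `H`-orbits. -/
lemma isLeftMultiadjoint_induction : IsLeftMultiadjoint (inductionFunctor H (p := p)) := by
  intro P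
  let J := MulAction.orbitRel.Quotient H (Γ ⧸ P.subgroup)
  let x (j : J) : Γ := (Quotient.out j).out
  have hx : ∀ j : J, (Quotient.mk'' ((x j : Γ) : Γ ⧸ P.subgroup) : J) = j := fun j => by
    have h1 : ((x j : Γ) : Γ ⧸ P.subgroup) = Quotient.out j := Quotient.out_eq' _
    rw [h1]
    exact Quotient.out_eq' j
  refine ⟨J, fun j => pointStabilizer H P (x j), fun j => fromPointStabilizer H P (x j),
    fun R f => ?_⟩
  obtain ⟨a, ha, rfl⟩ := exists_eq_homMk f
  -- the orbit of the image of the coset of `1`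
  let j : J := Quotient.mk'' ((a : Γ) : Γ ⧸ P.subgroup)
  have hrel : ∃ h : H, (h : Γ) • ((x j : Γ) : Γ ⧸ P.subgroup) = (a : Γ) := by
    have := Quotient.exact' (hx j)
    rw [MulAction.orbitRel_apply] at this
    obtain ⟨h, hh⟩ := this
    exact ⟨h⁻¹, inv_smul_eq_iff.2 hh.symm⟩
  obtain ⟨h, hh⟩ := hrel
  rw [MulAction.Quotient.smul_coe, smul_eq_mul, QuotientGroup.eq] at hh
  have hle : R.subgroup ≤ MulAut.conj h • (pointStabilizer H P (x j)).subgroup := by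
    intro r hr
    rw [mem_conj_smul, mem_pointStabilizer]
    have h1 := ha (Subgroup.mem_map_of_mem H.subtype hr)
    rw [mem_conj_smul] at h1
    have := P.subgroup.mul_mem (P.subgroup.mul_mem hh h1) (P.subgroup.inv_mem hh)
    simpa [mul_assoc] using this
  refine ⟨⟨j, homMk h hle⟩, ?_, ?_⟩
  · dsimp only
    exact (induction_map_comp_eq_iff H hle _ ha).2 hh
  · rintro ⟨j', f'⟩ hf'
    obtain ⟨h', hle', rfl⟩ := exists_eq_homMk f'
    replace hf' := (induction_map_comp_eq_iff H hle' _ ha).1 hf'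
    have hj : j' = j := by
      rw [← hx j']
      refine Quotient.sound' ?_
      rw [MulAction.orbitRel_apply]
      refine ⟨h'⁻¹, ?_⟩
      change (h' : Γ)⁻¹ • ((a : Γ) : Γ ⧸ P.subgroup) = _
      rw [inv_smul_eq_iff, MulAction.Quotient.smul_coe, smul_eq_mul, eq_comm, QuotientGroup.eq]
      exact hf'
    subst hj
    congr 1
    rw [homMk_eq_homMk_iff, mem_pointStabilizer]
    have := P.subgroup.mul_mem hf' (P.subgroup.inv_mem hh)
    simpa [mul_assoc] using this

end OrbitCat

variable {Y : Type u} [MulAction Γ Y] {k : Type} [CommRing k]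
  {V : Type} [AddCommGroup V] [Module k V]

open OrbitCat

section

variable {H} {W : OrbitSupport Γ ((Γ ⧸ H) × Y)} {W' : OrbitSupport H Y}
  (hW : ∀ (a : Γ) (P : Subgroup Γ) (y : Y), IsPGroup p P →
    ((((a⁻¹ : Γ) : Γ ⧸ H), a⁻¹ • y) ∈ W.points P ↔
      y ∈ W'.points ((MulAut.conj a • P).subgroupOf H)))

include hW in
lemma one_mem_points_iff (R : OrbitCat p H) (y : Y) :
    (((1 : Γ) : Γ ⧸ H), y) ∈ W.points (inductionObj H R).subgroup ↔ y ∈ W'.points R.subgroup := by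
  have := hW 1 _ y (inductionObj H R).isPGroup
  unfold inductionObj at this ⊢
  rwa [inv_one, one_smul, map_one, one_smul, subgroupOf_map_subtype] at this

variable (p k V) in
/-- The evaluation at the base point of `Γ ⧸ H`. -/
def evalBase : (inductionFunctor H).op ⋙ supportedFunctor k V p W ⟶ supportedFunctor k V p W' where
  app R := ModuleCat.ofHom (X := supportedValue k V W (inductionObj H R.unop).subgroup)
    { toFun := fun φ => ⟨fun y => φ.1 (((1 : Γ) : Γ ⧸ H), y), fun h hh y => by
        refine Eq.trans (congrArg φ.1 (?_ : _ = (h : Γ) • (((1 : Γ) : Γ ⧸ H), y)))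
          (φ.2.1 h (coe_mem_inductionObj H hh) (((1 : Γ) : Γ ⧸ H), y))
        refine Prod.ext ?_ rfl
        change ((1 : Γ) : Γ ⧸ H) = ((h * 1 : Γ) : Γ ⧸ H)
        rw [QuotientGroup.eq]
        simp, fun y hy => φ.2.2 _ (mt (one_mem_points_iff hW _ y).1 hy)⟩
      map_add' := fun _ _ => rfl
      map_smul' := fun _ _ => rfl }
  naturality R R' f := by
    refine ModuleCat.hom_ext (LinearMap.ext
      fun (φ : supportedValue k V W (inductionObj H R.unop).subgroup) =>
        Subtype.ext (funext fun y => ?_))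
    let h : H := rep f.unop
    have hle : R'.unop.subgroup ≤ MulAut.conj h • R.unop.subgroup := subgroup_le_conj_rep f.unop
    have e : (supportedFunctor k V p W).map ((inductionFunctor H).map f.unop).op φ =
        supportedMap W (h : Γ) (inductionObj_le_conj H hle) φ :=
      supportedFunctor_map_homMk W (S := inductionObj H R'.unop) (T := inductionObj H R.unop)
        (inductionObj_le_conj H hle) φ
    change ((supportedFunctor k V p W).map ((inductionFunctor H).map f.unop).op φ).1
      (((1 : Γ) : Γ ⧸ H), y) = (supportedMap W' h hle ⟨fun y => φ.1 (((1 : Γ) : Γ ⧸ H), y), _⟩).1 y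
    rw [e]
    by_cases hy : y ∈ W'.points R'.unop.subgroup
    · refine (supportedMap_apply_of_mem (W := W) (inductionObj_le_conj H hle) φ
        ((one_mem_points_iff hW _ y).2 hy)).trans ?_
      refine Eq.trans ?_ (supportedMap_apply_of_mem (W := W') hle _ hy).symm
      refine congrArg φ.1 (Prod.ext ?_ rfl)
      change (((h : Γ)⁻¹ * 1 : Γ) : Γ ⧸ H) = ((1 : Γ) : Γ ⧸ H)
      rw [QuotientGroup.eq]
      simp
    · rw [(supportedMap W' h hle _).2.2 y hy]
      exact (supportedMap W _ (inductionObj_le_conj H hle) _).2.2 _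
        (mt (one_mem_points_iff hW _ y).1 hy)

variable (X : (OrbitCat p Γ)ᵒᵖ ⥤ ModuleCat.{u} k)
  (β : (inductionFunctor H).op ⋙ X ⟶ supportedFunctor k V p W')

/-- The value at the point `(a⁻¹ H, y)` of the function on `(Γ ⧸ H) × Y` which corresponds
to `ξ`. -/
def liftValue (P : OrbitCat p Γ) (a : Γ) (ξ : X.obj (op P)) (y : Y) : V :=
  (β.app (op (pointStabilizer H P a)) (X.map (fromPointStabilizer H P a).op ξ) :
    supportedValue k V W' (pointStabilizer H P a).subgroup).1 (a • y)

/-- The compatibility of `liftValue` with a map `P' ⟶ P` of orbits, right multiplication by `c`. It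
includes the independence of the representative `a` of the coset `a⁻¹ H`, for `c = 1`. -/
lemma liftValue_map {P P' : OrbitCat p Γ} {c : Γ}
    (hc : P'.subgroup ≤ MulAut.conj c • P.subgroup) {a a' : Γ} {h : H} (hh : h * a = a' * c)
    (ξ : X.obj (op P)) {y : Y} (hy : a' • y ∈ W'.points (pointStabilizer H P' a').subgroup) :
    liftValue X β P' a' (X.map (homMk c hc).op ξ) y = liftValue X β P a ξ (c⁻¹ • y) := by
  have hle : (pointStabilizer H P' a').subgroup ≤
      MulAut.conj h • (pointStabilizer H P a).subgroup := by
    intro s hs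
    rw [mem_conj_smul, mem_pointStabilizer]
    have h1 := hc ((mem_pointStabilizer H).1 hs)
    rw [mem_conj_smul] at h1
    have h2 : (h : Γ)⁻¹ = a * (a' * c)⁻¹ := by
      rw [← hh]
      group
    have h3 : (h : Γ) = a' * c * a⁻¹ := by
      rw [← hh]
      group
    change a⁻¹ * ((h : Γ)⁻¹ * s * h) * a ∈ P.subgroup
    rw [h2, h3]
    simpa [mul_assoc] using h1
  have hcomp : (inductionFunctor H).map (homMk h hle) ≫ fromPointStabilizer H P a =
      fromPointStabilizer H P' a' ≫ homMk c hc := by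
    have e : fromPointStabilizer H P' a' ≫ homMk c hc = homMk (a' * c)
        (le_conj_mul (map_pointStabilizer_le H P' a') hc) := homMk_comp _ _
    rw [e]
    refine (induction_map_comp_eq_iff H hle _ _).2 ?_
    rw [hh, inv_mul_cancel]
    exact P.subgroup.one_mem
  have hX : X.map (fromPointStabilizer H P' a').op (X.map (homMk c hc).op ξ) =
      X.map ((inductionFunctor H).map (homMk h hle)).op
        (X.map (fromPointStabilizer H P a).op ξ) := by
    rw [← functor_map_comp_apply, ← functor_map_comp_apply, hcomp]
  unfold liftValue
  rw [hX]
  have hβ := functor_naturality_apply β (homMk h hle) (X.map (fromPointStabilizer H P a).op ξ)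
  replace hβ := hβ.trans (supportedFunctor_map_homMk W' hle
    (β.app (op (pointStabilizer H P a)) (X.map (fromPointStabilizer H P a).op ξ)))
  refine (congrFun (congrArg Subtype.val hβ) _).trans ?_
  refine (supportedMap_apply_of_mem (W := W') hle _ hy).trans ?_
  refine congrArg _ ?_
  change (h : Γ)⁻¹ • a' • y = a • c⁻¹ • y
  rw [inv_smul_eq_iff, smul_smul, smul_smul, hh, mul_inv_cancel_right]

lemma liftValue_eq_zero {P : OrbitCat p Γ} {a : Γ} (ξ : X.obj (op P)) {y : Y}
    (hy : a • y ∉ W'.points (pointStabilizer H P a).subgroup) : liftValue X β P a ξ y = 0 :=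
  (β.app (op (pointStabilizer H P a)) (X.map (fromPointStabilizer H P a).op ξ) :
    supportedValue k V W' (pointStabilizer H P a).subgroup).2.2 _ hy

include hW in
lemma smul_mem_points_iff (P : OrbitCat p Γ) (a : Γ) (y : Y) :
    a • y ∈ W'.points (pointStabilizer H P a).subgroup ↔
      (((a⁻¹ : Γ) : Γ ⧸ H), y) ∈ W.points P.subgroup := by
  rw [pointStabilizer, ← hW _ _ _ P.isPGroup, inv_smul_smul]

include hW in
lemma liftValue_map_out {P P' : OrbitCat p Γ} {c : Γ}
    (hc : P'.subgroup ≤ MulAut.conj c • P.subgroup) (ξ : X.obj (op P)) {t : Γ ⧸ H} {y : Y}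
    (hy : (t, y) ∈ W.points P'.subgroup) :
    liftValue X β P' t.out⁻¹ (X.map (homMk c hc).op ξ) y =
      liftValue X β P (c⁻¹ • t).out⁻¹ ξ (c⁻¹ • y) := by
  have h : t.out⁻¹ * c * (c⁻¹ • t).out ∈ H := by
    have : ((c⁻¹ * t.out : Γ) : Γ ⧸ H) = ((c⁻¹ • t).out : Γ) := by
      rw [QuotientGroup.out_eq']
      change c⁻¹ • ((t.out : Γ) : Γ ⧸ H) = _
      rw [QuotientGroup.out_eq']
    rw [QuotientGroup.eq] at this
    simpa [mul_assoc] using this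
  refine liftValue_map X β hc (h := ⟨_, h⟩) (mul_inv_cancel_right _ _) ξ ?_
  rw [smul_mem_points_iff hW, inv_inv, QuotientGroup.out_eq']
  exact hy

include hW in
lemma liftValue_eq_zero_of_notMem (P : OrbitCat p Γ) (ξ : X.obj (op P)) {z : (Γ ⧸ H) × Y}
    (hz : z ∉ W.points P.subgroup) : liftValue X β P z.1.out⁻¹ ξ z.2 = 0 := by
  refine liftValue_eq_zero X β ξ ?_
  rwa [smul_mem_points_iff hW, inv_inv, QuotientGroup.out_eq']

lemma apply_eq_liftValue (f : X ⟶ supportedFunctor k V p W) (P : OrbitCat p Γ)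
    (ξ : X.obj (op P)) (z : (Γ ⧸ H) × Y) :
    (f.app (op P) ξ : supportedValue k V W P.subgroup).1 z =
      liftValue X ((restrictFunctor k (inductionFunctor H)).map f ≫ evalBase p k V hW) P
        z.1.out⁻¹ ξ z.2 := by
  by_cases hz : z ∈ W.points P.subgroup
  · let a := z.1.out⁻¹
    have ha : a⁻¹ • (((1 : Γ) : Γ ⧸ H), a • z.2) = z := by
      refine Prod.ext ?_ (inv_smul_smul a z.2)
      change ((a⁻¹ * 1 : Γ) : Γ ⧸ H) = z.1
      rw [mul_one, inv_inv, QuotientGroup.out_eq']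
    have hf := (functor_naturality_apply f (fromPointStabilizer H P a) ξ).trans
      (supportedFunctor_map_homMk W (map_pointStabilizer_le H P a) _)
    have hmem : (((1 : Γ) : Γ ⧸ H), a • z.2) ∈
        W.points ((inductionFunctor H).obj (pointStabilizer H P a)).subgroup := by
      refine (one_mem_points_iff hW _ _).2 ((smul_mem_points_iff hW P a _).2 ?_)
      rwa [inv_inv, QuotientGroup.out_eq']
    refine Eq.trans ?_ (congrFun (congrArg Subtype.val hf) (((1 : Γ) : Γ ⧸ H), a • z.2)).symm
    refine Eq.trans ?_
      (supportedMap_apply_of_mem (W := W) (map_pointStabilizer_le H P a) _ hmem).symm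
    rw [ha]
  · rw [liftValue_eq_zero_of_notMem hW X _ P ξ hz]
    exact (f.app (op P) ξ : supportedValue k V W P.subgroup).2.2 z hz

include hW in
lemma liftValue_base (R : OrbitCat p H) (ξ : X.obj (op ((inductionFunctor H).obj R))) (y : Y) :
    liftValue X β ((inductionFunctor H).obj R) ((1 : Γ) : Γ ⧸ H).out⁻¹ ξ y =
      (β.app (op R) ξ : supportedValue k V W' R.subgroup).1 y := by
  have ha : ((1 : Γ) : Γ ⧸ H).out ∈ H := by
    have : ((1 : Γ) : Γ ⧸ H) = (((1 : Γ) : Γ ⧸ H).out : Γ) := (QuotientGroup.out_eq' _).symm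
    rw [QuotientGroup.eq] at this
    simpa using this
  by_cases hy : y ∈ W'.points R.subgroup
  · let h : H := ⟨_, ha⟩
    let S := pointStabilizer H ((inductionFunctor H).obj R) ((1 : Γ) : Γ ⧸ H).out⁻¹
    have hle : R.subgroup ≤ MulAut.conj h • S.subgroup := by
      intro s hs
      rw [mem_conj_smul, mem_pointStabilizer]
      have : ((1 : Γ) : Γ ⧸ H).out⁻¹⁻¹ * (h⁻¹ * s * h : H) * ((1 : Γ) : Γ ⧸ H).out⁻¹ = (s : Γ) := by
        change h.1⁻¹⁻¹ * (h.1⁻¹ * s * h.1) * h.1⁻¹ = (s : Γ)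
        group
      rw [this]
      exact coe_mem_inductionObj H hs
    have hcomp : (inductionFunctor H).map (homMk h hle) ≫ fromPointStabilizer H _ _ =
        𝟙 ((inductionFunctor H).obj R) := by
      rw [← homMk_of_mem (S := (inductionFunctor H).obj R) (Subgroup.one_mem _)]
      refine (induction_map_comp_eq_iff H hle _ _).2 ?_
      change (h.1 * h.1⁻¹)⁻¹ * 1 ∈ _
      rw [mul_inv_cancel, inv_one, one_mul]
      exact Subgroup.one_mem _
    have hX : X.map ((inductionFunctor H).map (homMk h hle)).op
        (X.map (fromPointStabilizer H _ _).op ξ) = ξ := by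
      rw [← functor_map_comp_apply, hcomp, op_id, X.map_id]
      rfl
    have hβ := (functor_naturality_apply β (homMk h hle)
      (X.map (fromPointStabilizer H _ _).op ξ)).trans (supportedFunctor_map_homMk W' hle _)
    have hβ' := congrArg (β.app (op R)) hX
    have := congrFun (congrArg Subtype.val (hβ'.symm.trans hβ)) y
    exact (this.trans (supportedMap_apply_of_mem (W := W') hle _ hy)).symm
  · rw [(β.app (op R) ξ : supportedValue k V W' R.subgroup).2.2 y hy]
    refine liftValue_eq_zero_of_notMem hW X β _ ξ (z := (((1 : Γ) : Γ ⧸ H), y)) ?_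
    exact mt (one_mem_points_iff hW _ y).1 hy

/-- The universal property of coinduction: the functions on `(Γ ⧸ H) × Y` represent the morphisms
from restrictions along induction to functions on `Y`. -/
lemma bijective_comp_evalBase :
    Function.Bijective fun f : X ⟶ supportedFunctor k V p W =>
      (restrictFunctor k (inductionFunctor H)).map f ≫ evalBase p k V hW := by
  constructor
  · intro f f' hff
    ext S : 2
    refine ModuleCat.hom_ext (LinearMap.ext fun ξ => Subtype.ext (funext fun z => ?_))
    refine (apply_eq_liftValue hW X f S.unop ξ z).trans ?_
    refine Eq.trans ?_ (apply_eq_liftValue hW X f' S.unop ξ z).symm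
    dsimp only at hff
    rw [hff]
  · intro β
    have hinv : ∀ (P : OrbitCat p Γ) (ξ : X.obj (op P)), ∀ g ∈ P.subgroup, ∀ z : (Γ ⧸ H) × Y,
        liftValue X β P (g • z).1.out⁻¹ ξ (g • z).2 = liftValue X β P z.1.out⁻¹ ξ z.2 := by
      intro P ξ g hg z
      by_cases hz : z ∈ W.points P.subgroup
      · have h := liftValue_map_out hW X β (conj_smul_of_mem (P.subgroup.inv_mem hg)).ge ξ hz
        rw [homMk_of_mem (P.subgroup.inv_mem hg), op_id, X.map_id, inv_inv] at h
        exact h.symm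
      · rw [liftValue_eq_zero_of_notMem hW X β P ξ hz, liftValue_eq_zero_of_notMem hW X β P ξ
          (mt (W.smul_mem_iff_of_mem hg z).1 hz)]
    let f : X ⟶ supportedFunctor k V p W :=
      { app := fun S => ModuleCat.ofHom
          (Y := supportedValue k V W S.unop.subgroup)
          { toFun := fun ξ => ⟨fun z => liftValue X β S.unop z.1.out⁻¹ ξ z.2, hinv S.unop ξ,
              fun z hz => liftValue_eq_zero_of_notMem hW X β S.unop ξ hz⟩
            map_add' := fun ξ ξ' => Subtype.ext (funext fun z => by
              simp only [liftValue, map_add]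
              rfl)
            map_smul' := fun r ξ => Subtype.ext (funext fun z => by
              simp only [liftValue, map_smul]
              rfl) }
        naturality := fun S S' θ => by
          refine ModuleCat.hom_ext (LinearMap.ext fun ξ => Subtype.ext (funext fun z => ?_))
          have hc := subgroup_le_conj_rep θ.unop
          have hθ : θ = (homMk (rep θ.unop) hc).op := by rw [homMk_rep, Quiver.Hom.op_unop]
          change liftValue X β S'.unop z.1.out⁻¹ (X.map θ ξ) z.2 = (supportedMap W _ hc
            ⟨fun z => liftValue X β S.unop z.1.out⁻¹ ξ z.2, _⟩).1 z
          by_cases hz : z ∈ W.points S'.unop.subgroup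
          · refine Eq.trans ?_ (supportedMap_apply_of_mem (W := W) hc _ hz).symm
            refine Eq.trans ?_ (liftValue_map_out hW X β hc ξ hz)
            exact congrArg (fun θ' : S ⟶ S' => liftValue X β S'.unop z.1.out⁻¹ (X.map θ' ξ) z.2) hθ
          · rw [(supportedMap W _ _ _).2.2 z hz]
            exact liftValue_eq_zero_of_notMem hW X β S'.unop _ hz }
    refine ⟨f, ?_⟩
    ext R : 2
    refine ModuleCat.hom_ext (LinearMap.ext fun ξ => Subtype.ext (funext fun y => ?_))
    exact liftValue_base hW X β R.unop ξ y

end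

/-- Shapiro's lemma for functions on `(Γ ⧸ H) × Y`. -/
lemma subsingleton_ext_coinduced {W : OrbitSupport Γ ((Γ ⧸ H) × Y)} {W' : OrbitSupport H Y}
    (hW : ∀ (a : Γ) (P : Subgroup Γ) (y : Y), IsPGroup p P →
      ((((a⁻¹ : Γ) : Γ ⧸ H), a⁻¹ • y) ∈ W.points P ↔
        y ∈ W'.points ((MulAut.conj a • P).subgroupOf H))) (n : ℕ)
    [Subsingleton (Ext (constFunctor (OrbitCat p H) k) (supportedFunctor k V p W') n)] :
    Subsingleton (Ext (constFunctor (OrbitCat p Γ) k) (supportedFunctor k V p W) n) :=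
  (subsingleton_ext_restrict_iff (isLeftMultiadjoint_induction H) (evalBase p k V hW)
    (fun X => bijective_comp_evalBase hW X) n _).2 ‹_›

end Induction

/-! ### Acyclicity from Sylow subgroups and from normal `p`-subgroups -/

section Terminal

variable {p : ℕ} {Γ : Type u} [Group Γ]

/-- The `p`-orbit category of a `p`-group has the one-point orbit as terminal object. -/
def OrbitCat.isTerminalTop (hΓ : IsPGroup p Γ) :
    IsTerminal (⟨⊤, hΓ.to_subgroup ⊤⟩ : OrbitCat p Γ) :=
  IsTerminal.ofUniqueHom
    (fun _ => OrbitCat.homMk 1 (by rw [map_one, one_smul]; exact le_top))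
    (fun S m => OrbitCat.hom_ext_one (by
      have : Subsingleton (Γ ⧸ (⊤ : Subgroup Γ)) := QuotientGroup.subsingleton_quotient_top
      exact Subsingleton.elim (α := Γ ⧸ (⊤ : Subgroup Γ)) _ _))

end Terminal

lemma map_subtype_conj {Γ : Type u} [Group Γ] (H : Subgroup Γ) (h : H) (R : Subgroup H) :
    (MulAut.conj h • R).map H.subtype = MulAut.conj (h : Γ) • R.map H.subtype := by
  refine le_antisymm (map_subtype_le_conj H le_rfl) fun x hx => ?_
  rw [mem_conj_smul] at hx
  obtain ⟨r, hr, hrx⟩ := hx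
  refine ⟨h * r * h⁻¹, ?_, ?_⟩
  · change h * r * h⁻¹ ∈ MulAut.conj h • R
    rw [mem_conj_smul]
    simpa [mul_assoc] using hr
  · change (h : Γ) * H.subtype r * (h : Γ)⁻¹ = x
    rw [hrx]
    group

namespace ConvexFamily

variable {Γ : Type u} [Group Γ] (𝒬 : ConvexFamily Γ)

/-- The points of a `Γ`-set whose stabilizer in the subgroup `R` of `H` belongs to the family. -/
def supportOn (H : Subgroup Γ) (Y : Type u) [MulAction Γ Y] : OrbitSupport H Y where
  points R := {y | R.map H.subtype ⊓ MulAction.stabilizer Γ y ∈ 𝒬.carrier}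
  smul_mem' h R y hy := by
    change _ ⊓ MulAction.stabilizer Γ ((h : Γ) • y) ∈ 𝒬.carrier
    rw [map_subtype_conj, conj_inf_stabilizer]
    exact 𝒬.conj_mem _ hy
  convex h₁ h₂ := 𝒬.convex (inf_le_inf_right _ (Subgroup.map_mono h₁))
    (inf_le_inf_right _ (Subgroup.map_mono h₂))

lemma mem_support_prod_quotient (H : Subgroup Γ) {Y : Type u} [MulAction Γ Y] (a : Γ)
    (P : Subgroup Γ) (y : Y) :
    (((a⁻¹ : Γ) : Γ ⧸ H), a⁻¹ • y) ∈ (𝒬.support ((Γ ⧸ H) × Y)).points P ↔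
      y ∈ (𝒬.supportOn H Y).points ((MulAut.conj a • P).subgroupOf H) := by
  have h1 : (((a⁻¹ : Γ) : Γ ⧸ H), a⁻¹ • y) = a⁻¹ • ((((1 : Γ) : Γ ⧸ H), y) : (Γ ⧸ H) × Y) := by
    refine Prod.ext ?_ rfl
    change ((a⁻¹ : Γ) : Γ ⧸ H) = ((a⁻¹ * 1 : Γ) : Γ ⧸ H)
    rw [mul_one]
  have h2 : MulAut.conj a • P ⊓ MulAction.stabilizer Γ ((((1 : Γ) : Γ ⧸ H), y) : (Γ ⧸ H) × Y) =
      ((MulAut.conj a • P).subgroupOf H).map H.subtype ⊓ MulAction.stabilizer Γ y := by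
    rw [Subgroup.subgroupOf_map_subtype, inf_assoc]
    congr 1
    ext x
    rw [Subgroup.mem_inf, MulAction.mem_stabilizer_iff, MulAction.mem_stabilizer_iff, Prod.smul_mk,
      Prod.mk.injEq, MulAction.Quotient.smul_coe, smul_eq_mul, mul_one, eq_comm, QuotientGroup.eq,
      inv_one, one_mul]
  rw [h1, OrbitSupport.inv_smul_mem_iff]
  change _ ∈ 𝒬.carrier ↔ _ ∈ 𝒬.carrier
  rw [h2]

variable {p : ℕ} {Y : Type u} [MulAction Γ Y]

/-- Shapiro's lemma for a Sylow subgroup: its orbit category has a terminal object. -/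
lemma subsingleton_ext_support_prod_sylow (k : Type) [CommRing k] (V : Type) [AddCommGroup V]
    [Module k V] (S : Sylow p Γ) (n : ℕ) :
    Subsingleton (Ext (constFunctor (OrbitCat p Γ) k)
      (supportedFunctor k V p (𝒬.support ((Γ ⧸ (S : Subgroup Γ)) × Y))) (n + 1)) := by
  have : Projective (constFunctor (OrbitCat p S) k) :=
    projective_constFunctor (OrbitCat.isTerminalTop S.isPGroup')
  have : Subsingleton (Ext (constFunctor (OrbitCat p S) k)
      (supportedFunctor k V p (𝒬.supportOn S Y)) (n + 1)) :=
    subsingleton_of_forall_eq 0 Ext.eq_zero_of_projective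
  exact subsingleton_ext_coinduced (S : Subgroup Γ)
    (fun a P y _ => 𝒬.mem_support_prod_quotient S a P y) (n + 1)

/-- Functions supported on the points whose stabilizers belong to a convex family have no higher
limits: modulo `p` the transfer reduces this to a Sylow subgroup. -/
theorem subsingleton_ext_support [Fact p.Prime] [Finite Γ] [Finite Y] (k : Type) [CommRing k]
    [IsDomain k] [IsNoetherianRing k] [IsLocalRing k] (hp : (p : k) ≠ 0)
    (hp' : (p : k) ∈ IsLocalRing.maximalIdeal k) (n : ℕ) :
    Subsingleton (Ext (constFunctor (OrbitCat p Γ) k)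
      (supportedFunctor k k p (𝒬.support Y)) (n + 1)) := by
  obtain ⟨S⟩ : Nonempty (Sylow p Γ) := inferInstance
  have : Fintype (Γ ⧸ (S : Subgroup Γ)) := Fintype.ofFinite _
  have hT : ¬ p ∣ Fintype.card (Γ ⧸ (S : Subgroup Γ)) := by
    rw [← Nat.card_eq_fintype_card]
    exact S.not_dvd_index
  have hV : ∀ v : k ⧸ Ideal.span {(p : k)}, p • v = 0 := fun v => by
    obtain ⟨x, rfl⟩ := Ideal.Quotient.mk_surjective v
    rw [nsmul_eq_mul, ← map_natCast (Ideal.Quotient.mk (Ideal.span {(p : k)})), ← map_mul]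
    exact Ideal.Quotient.eq_zero_iff_mem.2
      (Ideal.mul_mem_right _ _ (Ideal.mem_span_singleton_self _))
  obtain ⟨s, r, hsr⟩ := 𝒬.exists_retract k (k ⧸ Ideal.span {(p : k)}) Y
    (Γ ⧸ (S : Subgroup Γ)) hV hT
  have := 𝒬.subsingleton_ext_support_prod_sylow (Y := Y) k (k ⧸ Ideal.span {(p : k)}) S n
  have := subsingleton_ext_of_retract (X := constFunctor (OrbitCat p Γ) k) s r hsr (n + 1)
  obtain ⟨g, w, hS⟩ := exists_shortExact_smul p k hp (𝒬.support Y)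
  have : Module.Finite k (Ext (constFunctor (OrbitCat p Γ) k)
      (supportedFunctor k k p (𝒬.support Y)) (n + 1)) :=
    finite_ext (n + 1) _ _ (fun _ => Module.Finite.equiv ULift.moduleEquiv.symm) inferInstance
  exact subsingleton_ext_of_smul (p : k) hp' g w hS _ (n + 1)

end ConvexFamily

section Reflection

variable {p : ℕ} {H : Type u} [Group H] {Q : Subgroup H} [Q.Normal]

lemma sup_le_conj_smul_sup {R S : Subgroup H} {a : H} (h : R ≤ MulAut.conj a • S) :
    R ⊔ Q ≤ MulAut.conj a • (S ⊔ Q) := by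
  refine sup_le (h.trans (Subgroup.pointwise_smul_le_pointwise_smul_iff.2 le_sup_left)) ?_
  intro q hq
  rw [mem_conj_smul]
  refine Subgroup.mem_sup_right ?_
  simpa using Subgroup.Normal.conj_mem ‹_› q hq a⁻¹

lemma le_of_le_conj_smul {S : Subgroup H} {a : H} (h : Q ≤ MulAut.conj a • S) : Q ≤ S := by
  intro q hq
  have := h (Subgroup.Normal.conj_mem ‹_› q hq a)
  rw [mem_conj_smul] at this
  simpa [mul_assoc] using this

namespace OrbitCat

/-- Passage to the orbits of the normal `p`-subgroup `Q`: the reflection onto the orbits `H ⧸ R`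
with `Q ≤ R`. -/
def supFunctor (hQ : IsPGroup p Q) : OrbitCat p H ⥤ OrbitCat p H where
  obj R := ⟨R.subgroup ⊔ Q, R.isPGroup.to_sup_of_normal_right hQ⟩
  map {R R'} f := homMk (rep f) (sup_le_conj_smul_sup (subgroup_le_conj_rep f))
  map_id R := by
    have h : rep (𝟙 R) ∈ R.subgroup := by
      have : ((1 : H) : H ⧸ R.subgroup) = (rep (𝟙 R) : H) := (mk_rep (𝟙 R)).symm
      rw [QuotientGroup.eq] at this
      simpa using this
    exact homMk_of_mem (Subgroup.mem_sup_left h)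
  map_comp {R S T} f g := by
    rw [homMk_comp, homMk_eq_homMk_iff]
    have h := homMk_comp (subgroup_le_conj_rep f) (subgroup_le_conj_rep g)
    rw [homMk_rep, homMk_rep, ← homMk_rep (f ≫ g), homMk_eq_homMk_iff] at h
    exact Subgroup.mem_sup_left h

variable (hQ : IsPGroup p Q)

lemma supFunctor_map_homMk {R R' : OrbitCat p H} {a : H}
    (h : R.subgroup ≤ MulAut.conj a • R'.subgroup) :
    (supFunctor hQ).map (homMk a h) = homMk (S := (supFunctor hQ).obj R)
      (T := (supFunctor hQ).obj R') a (sup_le_conj_smul_sup h) :=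
  (homMk_eq_homMk_iff (sup_le_conj_smul_sup (subgroup_le_conj_rep _)) _).2
    (Subgroup.mem_sup_left (inv_rep_homMk_mul_mem a h))

lemma supFunctor_map_comp {R S T : OrbitCat p H} {a b : H}
    (ha : R.subgroup ≤ MulAut.conj a • S.subgroup)
    (hb : ((supFunctor hQ).obj S).subgroup ≤ MulAut.conj b • T.subgroup) :
    (supFunctor hQ).map (homMk a ha) ≫ homMk b hb =
      homMk (a * b) (le_conj_mul (sup_le_conj_smul_sup ha) hb) := by
  rw [supFunctor_map_homMk]
  exact homMk_comp _ _

lemma isLeftMultiadjoint_supFunctor : IsLeftMultiadjoint (supFunctor hQ) := by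
  intro S
  by_cases hS : Q ≤ S.subgroup
  · have h1 : ((supFunctor hQ).obj S).subgroup ≤ MulAut.conj (1 : H) • S.subgroup :=
      le_conj_one (sup_le le_rfl hS)
    refine ⟨PUnit, fun _ => S, fun _ => homMk 1 h1, fun R f => ?_⟩
    obtain ⟨a, ha, rfl⟩ := exists_eq_homMk f
    have ha' : R.subgroup ≤ MulAut.conj a • S.subgroup := le_sup_left.trans ha
    refine ⟨⟨⟨⟩, homMk a ha'⟩, ?_, ?_⟩
    · dsimp only
      rw [supFunctor_map_comp]
      exact (homMk_eq_homMk_iff _ _).2 (by simp)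
    · rintro ⟨⟨⟩, g⟩ hg
      obtain ⟨b, hb, rfl⟩ := exists_eq_homMk g
      dsimp only at hg
      rw [supFunctor_map_comp, homMk_eq_homMk_iff, mul_one] at hg
      congr 1
      exact (homMk_eq_homMk_iff _ _).2 hg
  · refine ⟨PEmpty, fun j => j.elim, fun j => j.elim, fun R f => ?_⟩
    obtain ⟨a, ha, rfl⟩ := exists_eq_homMk f
    exact absurd (le_of_le_conj_smul (le_sup_right.trans ha)) hS

end OrbitCat

open OrbitCat

variable {k : Type} [CommRing k]

/-- A functor which vanishes at all orbits `H ⧸ S` with `Q ≤ S`, for a normal `p`-subgroup `Q`, is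
acyclic: restriction along the reflection onto these orbits preserves constant functors. -/
lemma subsingleton_ext_of_normal (hQ : IsPGroup p Q) (G : (OrbitCat p H)ᵒᵖ ⥤ ModuleCat.{u} k)
    (hG : ∀ S : OrbitCat p H, Q ≤ S.subgroup → Subsingleton (G.obj (op S))) (n : ℕ) :
    Subsingleton (Ext (constFunctor (OrbitCat p H) k) G n) := by
  have hzero : ∀ (X : (OrbitCat p H)ᵒᵖ ⥤ ModuleCat.{u} k) (φ : (supFunctor hQ).op ⋙ X ⟶ G),
      φ = 0 := by
    intro X φ
    ext R : 2
    refine ModuleCat.hom_ext (LinearMap.ext fun ξ => ?_)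
    let L := (supFunctor hQ).obj R.unop
    have hη : R.unop.subgroup ≤ MulAut.conj (1 : H) • L.subgroup := le_conj_one le_sup_left
    have hr : ((supFunctor hQ).obj L).subgroup ≤ MulAut.conj (1 : H) • L.subgroup :=
      le_conj_one (sup_le le_rfl le_sup_right)
    have h1 : (supFunctor hQ).map (homMk 1 hη) ≫ homMk 1 hr = 𝟙 L := by
      rw [supFunctor_map_comp]
      exact homMk_of_mem (by rw [mul_one]; exact Subgroup.one_mem _)
    have h2 : X.map ((supFunctor hQ).map (homMk 1 hη)).op (X.map (homMk 1 hr).op ξ) = ξ := by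
      rw [← functor_map_comp_apply, h1, op_id, X.map_id]
      rfl
    have h3 := functor_naturality_apply φ (homMk 1 hη) (X.map (homMk 1 hr).op ξ)
    have := hG L le_sup_right
    rw [Subsingleton.elim (φ.app (op L) _) 0, map_zero] at h3
    exact (congrArg (φ.app R) h2).symm.trans h3
  let A : (OrbitCat p H)ᵒᵖ ⥤ ModuleCat.{u} k := 0
  have hA : IsZero A := isZero_zero _
  have hA' : Subsingleton (Ext (constFunctor (OrbitCat p H) k) A n) :=
    subsingleton_of_forall_eq 0 fun x => by
      rw [← x.comp_mk₀_id, hA.eq_of_src (𝟙 A) 0, Ext.mk₀_zero, Ext.comp_zero]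
  refine (subsingleton_ext_restrict_iff (isLeftMultiadjoint_supFunctor hQ)
    (A := A) (G := G) 0 (fun X => ?_) n _).1 hA'
  have h1 : Subsingleton (X ⟶ A) := ⟨hA.eq_of_tgt⟩
  refine ⟨fun _ _ _ => Subsingleton.elim _ _, fun φ => ⟨0, ?_⟩⟩
  rw [hzero X φ]
  exact hzero X _

end Reflection

/-! ### Free points and special subgroups -/

section FreePoints

variable {Γ : Type u} [Group Γ]

lemma conj_smul_ne_bot (g : Γ) {P : Subgroup Γ} (hP : P ≠ ⊥) : MulAut.conj g • P ≠ ⊥ := by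
  rwa [Ne, ← Subgroup.smul_bot (MulAut.conj g), smul_left_cancel_iff]

namespace ConvexFamily

/-- The points of a `Γ`-set on which `P` acts freely, for the subgroups `P` in the family. -/
def freeSupport (𝒬 : ConvexFamily Γ) (X : Type u) [MulAction Γ X] : OrbitSupport Γ X where
  points P := {x | P ⊓ MulAction.stabilizer Γ x = ⊥ ∧ P ∈ 𝒬.carrier}
  smul_mem' g P x hx := by
    refine ⟨?_, 𝒬.conj_mem g hx.2⟩
    rw [conj_inf_stabilizer, hx.1, Subgroup.smul_bot]
  convex h₁ h₂ hR hP := ⟨le_bot_iff.1 (hP.1 ▸ inf_le_inf_right _ h₂), 𝒬.convex h₁ h₂ hR.2 hP.2⟩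

variable (Γ) in
/-- The family which consists of the trivial subgroup. -/
def trivial : ConvexFamily Γ where
  carrier := {⊥}
  conj_mem g P hP := by
    rw [Set.mem_singleton_iff] at hP ⊢
    rw [hP, Subgroup.smul_bot]
  convex _ h₂ _ hP := le_bot_iff.1 (h₂.trans (le_of_eq hP))

variable (Γ) in
/-- The family of the non-trivial subgroups. -/
def nontrivial : ConvexFamily Γ where
  carrier := {P | P ≠ ⊥}
  conj_mem g _ hP := conj_smul_ne_bot g hP
  convex h₁ _ hR _ h := hR (le_bot_iff.1 (h₁.trans (le_of_eq h)))

end ConvexFamily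

variable (X : Type u) [MulAction Γ X]

/-- A non-trivial subgroup is special if it has a free orbit and acts trivially outside of it. -/
def IsSpecial (P : Subgroup Γ) : Prop :=
  P ≠ ⊥ ∧ ∃ x : X, P ⊓ MulAction.stabilizer Γ x = ⊥ ∧
    ∀ y : X, (∃ g ∈ P, g • x = y) ∨ ∀ g ∈ P, g • y = y

variable {X}

lemma eq_one_of_mem_of_smul_eq {P : Subgroup Γ} {x : X} (hx : P ⊓ MulAction.stabilizer Γ x = ⊥)
    {g : Γ} (hg : g ∈ P) (h : g • x = x) : g = 1 := by
  rw [← Subgroup.mem_bot, ← hx]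
  exact ⟨hg, h⟩

lemma inf_stabilizer_eq_bot_of_le {Q P : Subgroup Γ} (h : Q ≤ P) {x : X}
    (hx : P ⊓ MulAction.stabilizer Γ x = ⊥) : Q ⊓ MulAction.stabilizer Γ x = ⊥ :=
  le_bot_iff.1 (hx ▸ inf_le_inf_right _ h)

lemma IsSpecial.exists_smul_eq {P : Subgroup Γ} (hP : IsSpecial X P) {x y : X}
    (hx : P ⊓ MulAction.stabilizer Γ x = ⊥) :
    (∃ g ∈ P, g • x = y) ∨ ∀ g ∈ P, g • y = y := by
  obtain ⟨hne, x₀, -, h⟩ := hP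
  rcases h x with ⟨a, ha, rfl⟩ | hfix
  · rcases h y with ⟨b, hb, rfl⟩ | hy
    · exact Or.inl ⟨b * a⁻¹, P.mul_mem hb (P.inv_mem ha), by rw [mul_smul, inv_smul_smul]⟩
    · exact Or.inr hy
  · refine absurd ((Subgroup.eq_bot_iff_forall P).2 fun g hg => ?_) hne
    exact eq_one_of_mem_of_smul_eq hx hg (hfix g hg)

/-- A special subgroup is maximal among the subgroups with a free orbit. -/
lemma IsSpecial.eq_of_le {R P : Subgroup Γ} (hR : IsSpecial X R) (h : R ≤ P) {x : X}
    (hx : P ⊓ MulAction.stabilizer Γ x = ⊥) : R = P := by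
  refine le_antisymm h fun g hg => ?_
  rcases hR.exists_smul_eq (inf_stabilizer_eq_bot_of_le h hx) (y := g • x) with ⟨r, hr, hrx⟩ | hfix
  · have : g⁻¹ * r = 1 := eq_one_of_mem_of_smul_eq hx (P.mul_mem (P.inv_mem hg) (h hr)) (by
      rw [mul_smul, hrx, inv_smul_smul])
    rwa [← inv_mul_eq_one.1 this] at hr
  · refine absurd ((Subgroup.eq_bot_iff_forall R).2 fun r hr => ?_) hR.1
    have : g⁻¹ * r * g = 1 :=
      eq_one_of_mem_of_smul_eq hx (P.mul_mem (P.mul_mem (P.inv_mem hg) (h hr)) hg) (by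
        rw [mul_smul, mul_smul, hfix r hr, inv_smul_smul])
    rwa [mul_eq_one_iff_eq_inv, inv_mul_eq_iff_eq_mul, mul_inv_cancel] at this

lemma IsSpecial.conj {P : Subgroup Γ} (hP : IsSpecial X P) (g : Γ) :
    IsSpecial X (MulAut.conj g • P) := by
  obtain ⟨hne, x, hx, h⟩ := hP
  refine ⟨conj_smul_ne_bot g hne, g • x, ?_, fun y => ?_⟩
  · rw [ConvexFamily.conj_inf_stabilizer, hx, Subgroup.smul_bot]
  · rcases h (g⁻¹ • y) with ⟨a, ha, hy⟩ | hfix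
    · refine Or.inl ⟨g * a * g⁻¹, ?_, ?_⟩
      · rw [mem_conj_smul]
        simpa [mul_assoc] using ha
      · rw [mul_smul, mul_smul, inv_smul_smul, hy, smul_inv_smul]
    · refine Or.inr fun a ha => ?_
      rw [mem_conj_smul] at ha
      have := hfix _ ha
      rw [smul_smul, mul_assoc, mul_inv_cancel, mul_one, mul_smul] at this
      exact smul_left_cancel _ this

lemma isSpecial_conj_iff {P : Subgroup Γ} (g : Γ) :
    IsSpecial X (MulAut.conj g • P) ↔ IsSpecial X P := by
  refine ⟨fun h => ?_, fun h => h.conj g⟩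
  have := h.conj g⁻¹
  rwa [← mul_smul, ← map_mul, inv_mul_cancel, map_one, one_smul] at this

namespace ConvexFamily

variable (X)

/-- The family of the special subgroups. -/
def special : ConvexFamily Γ where
  carrier := {P | IsSpecial X P}
  conj_mem g _ hP := hP.conj g
  convex {R Q P} h₁ h₂ hR hP := by
    obtain ⟨-, x, hx, -⟩ := hP
    rwa [← hR.eq_of_le h₁ (inf_stabilizer_eq_bot_of_le h₂ hx)]

/-- The family of the non-trivial subgroups which have a free orbit and are not special. -/
def nonspecial : ConvexFamily Γ where
  carrier := {P | P ≠ ⊥ ∧ (∃ x : X, P ⊓ MulAction.stabilizer Γ x = ⊥) ∧ ¬ IsSpecial X P}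
  conj_mem := by
    rintro g P ⟨hne, ⟨x, hx⟩, hP⟩
    refine ⟨conj_smul_ne_bot g hne, ⟨g • x, ?_⟩, mt (isSpecial_conj_iff g).1 hP⟩
    rw [conj_inf_stabilizer, hx, Subgroup.smul_bot]
  convex := by
    rintro R Q P h₁ h₂ hR ⟨-, ⟨x, hx⟩, hP⟩
    refine ⟨fun h => hR.1 (le_bot_iff.1 (h₁.trans h.le)),
      ⟨x, inf_stabilizer_eq_bot_of_le h₂ hx⟩, fun hQ => hP ?_⟩
    rwa [← hQ.eq_of_le h₂ hx]

variable {X} {p : ℕ} (k : Type) [CommRing k]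

/-- The functor of functions on the free points of special subgroups only depends on the special
subgroup, since the free points form a single orbit. -/
lemma nonempty_iso_special :
    Nonempty (supportedFunctor k k p ((special (Γ := Γ) X).support PUnit.{u + 1}) ≅
      supportedFunctor k k p ((special (Γ := Γ) X).freeSupport X)) := by
  have htop : ∀ P : Subgroup Γ, P ⊓ MulAction.stabilizer Γ PUnit.unit.{u + 1} = P := fun P =>
    inf_eq_left.2 fun _ _ => rfl
  refine exists_iso_supportedFunctor p k k _ _ (fun _ => PUnit.unit) (fun _ _ => rfl) ?_ ?_ ?_ ?_
  · intro P x hx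
    change _ ∈ (special X).carrier
    rw [htop]
    exact hx.2
  · intro P y hy
    change P ⊓ MulAction.stabilizer Γ PUnit.unit ∈ (special X).carrier at hy
    rw [htop] at hy
    obtain ⟨x, hx, -⟩ := hy.2
    exact ⟨x, ⟨hx, hy⟩, rfl⟩
  · intro P x y hx hy _
    refine (hx.2.exists_smul_eq hx.1).resolve_right fun hfix => hx.2.1 ?_
    rw [Subgroup.eq_bot_iff_forall]
    exact fun g hg => eq_one_of_mem_of_smul_eq hy.1 hg (hfix g hg)
  · intro Q P x hQP hx hP
    change P ⊓ MulAction.stabilizer Γ PUnit.unit ∈ (special X).carrier at hP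
    rw [htop] at hP
    obtain ⟨x', hx', -⟩ := hP.2
    rwa [← hx.2.eq_of_le hQP hx']

variable (X p)

/-- The functions on the free points of the non-trivial subgroups are an extension of those for
the special subgroups by those for the other ones. -/
lemma exists_shortExact_nonspecial :
    ∃ (f : supportedFunctor k k p ((nonspecial (Γ := Γ) X).freeSupport X) ⟶
        supportedFunctor k k p ((nontrivial Γ).freeSupport X))
      (g : supportedFunctor k k p ((nontrivial Γ).freeSupport X) ⟶
        supportedFunctor k k p ((special X).freeSupport X)) (w : f ≫ g = 0),
      (ShortComplex.mk f g w).ShortExact := by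
  refine exists_shortExact_supportedFunctor p k k ?_ ?_ ?_
  · intro P
    ext x
    constructor
    · rintro ⟨hx, hP⟩
      by_cases h : IsSpecial X P
      · exact Or.inr ⟨hx, h⟩
      · exact Or.inl ⟨hx, hP, ⟨x, hx⟩, h⟩
    · rintro (⟨hx, hP⟩ | ⟨hx, hP⟩)
      · exact ⟨hx, hP.1⟩
      · exact ⟨hx, hP.1⟩
  · intro P
    rw [Set.disjoint_left]
    exact fun x hx hx' => hx.2.2.2 hx'.2
  · rintro Q P x - hQP ⟨hx, hP⟩ ⟨hx', hQ⟩
    refine ⟨hx', hQ, ⟨x, hx'⟩, fun h => hP.2.2 ?_⟩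
    rwa [← h.eq_of_le hQP hx]

/-- The functions which are supported at the trivial subgroup are a subfunctor of those on all free
points, with quotient the functions on the free points of non-trivial subgroups. -/
lemma exists_shortExact_nontrivial :
    ∃ (f : supportedFunctor k k p ((trivial Γ).freeSupport X) ⟶
        supportedFunctor k k p ((trivial Γ).support X))
      (g : supportedFunctor k k p ((trivial Γ).support X) ⟶
        supportedFunctor k k p ((nontrivial Γ).freeSupport X)) (w : f ≫ g = 0),
      (ShortComplex.mk f g w).ShortExact := by
  refine exists_shortExact_supportedFunctor p k k ?_ ?_ ?_
  · intro P
    ext x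
    constructor
    · intro hx
      by_cases h : P = ⊥
      · exact Or.inl ⟨hx, h⟩
      · exact Or.inr ⟨hx, h⟩
    · rintro (⟨hx, -⟩ | ⟨hx, -⟩)
      · exact hx
      · exact hx
  · intro P
    rw [Set.disjoint_left]
    exact fun x hx hx' => hx'.2 hx.2
  · rintro Q P x - hQP ⟨hx, hP⟩ hQ
    refine ⟨hQ, le_bot_iff.1 (hQP.trans (le_of_eq hP))⟩

/-- The functor `F_M` of the permutation module `M = k[X]`. -/
lemma nonempty_iso_atomicFunctor [Finite X] :
    Nonempty (atomicFunctor p (Rep.ofMulAction k Γ X) ≅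
      supportedFunctor k k p ((trivial Γ).freeSupport X)) := by
  let e : MonoidAlgebra k X ≃ₗ[k] (X → k) :=
    (MonoidAlgebra.coeffLinearEquiv k).trans (Finsupp.linearEquivFunOnFinite k k X)
  have he : ∀ (g : Γ) (m : MonoidAlgebra k X) (x : X),
      e ((Rep.ofMulAction k Γ X).ρ g m) x = e m (g⁻¹ • x) := fun g m x =>
    Representation.coeff_ofMulAction g m x
  have hbot : ∀ x : X, (⊥ : Subgroup Γ) ⊓ MulAction.stabilizer Γ x = ⊥ := fun x => bot_inf_eq _
  have hmem : ∀ (S : OrbitCat p Γ) (m : MonoidAlgebra k X),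
      m ∈ atomicValue (Rep.ofMulAction k Γ X) S ↔
        e m ∈ supportedValue k k ((trivial Γ).freeSupport X) S.subgroup := by
    intro S m
    constructor
    · intro hm
      by_cases hS : S.subgroup = ⊥
      · refine ⟨fun g hg x => ?_, fun x hx => absurd ?_ hx⟩
        · rw [hS, Subgroup.mem_bot] at hg
          rw [hg, one_smul]
        · exact ⟨by rw [hS]; exact hbot x, hS⟩
      · rw [hm hS, map_zero]
        exact Submodule.zero_mem _
    · intro hm hS
      refine e.injective (funext fun x => ?_)
      rw [map_zero]
      exact hm.2 x fun hx => hS hx.2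
  let i (S : (OrbitCat p Γ)ᵒᵖ) : atomicValue (Rep.ofMulAction k Γ X) S.unop ≃ₗ[k]
      supportedValue k k ((trivial Γ).freeSupport X) S.unop.subgroup :=
    e.ofSubmodules _ _ (by
      ext φ
      refine ⟨?_, fun hφ => ⟨e.symm φ, (hmem _ _).2 ?_, e.apply_symm_apply φ⟩⟩
      · rintro ⟨m, hm, rfl⟩
        exact (hmem _ _).1 hm
      · rwa [e.apply_symm_apply])
  refine ⟨NatIso.ofComponents (fun S => (i S).toModuleIso) fun {S T} f => ?_⟩
  refine ModuleCat.hom_ext (LinearMap.ext fun m => Subtype.ext (funext fun x => ?_))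
  have hc := OrbitCat.subgroup_le_conj_rep f.unop
  change (i T (atomicMap _ f.unop m)).1 x = (supportedMap _ _ hc (i S m)).1 x
  by_cases hx : x ∈ ((trivial Γ).freeSupport X).points T.unop.subgroup
  · refine Eq.trans ?_ (supportedMap_apply_of_mem hc _ hx).symm
    exact he _ _ _
  · rw [(supportedMap _ _ hc (i S m)).2.2 x hx]
    exact (i T _).2.2 x hx

end ConvexFamily

end FreePoints

/-! ### Conjugacy classes and the symmetric group -/

section ConjugacyClass

variable {Γ : Type u} [Group Γ]

lemma conj_smul_eq_iff (g g' : Γ) (P : Subgroup Γ) :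
    MulAut.conj g • P = MulAut.conj g' • P ↔ g⁻¹ * g' ∈ Subgroup.normalizer (P : Set Γ) := by
  rw [eq_comm, ← inv_smul_eq_iff, ← map_inv, ← mul_smul, ← map_mul]
  constructor
  · intro h
    rw [Subgroup.mem_normalizer_iff]
    intro x
    have := mem_conj_smul (g⁻¹ * g') ((g⁻¹ * g') * x * (g⁻¹ * g')⁻¹) P
    rw [h] at this
    rw [this]
    simp [mul_assoc]
  · intro h
    ext x
    rw [mem_conj_smul]
    simpa using (Subgroup.mem_normalizer_iff.1 (Subgroup.inv_mem _ h) x).symm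

lemma conj_smul_eq_self {P : Subgroup Γ} {g : Γ} (hg : g ∈ Subgroup.normalizer (P : Set Γ)) :
    MulAut.conj g • P = P := by
  have := (conj_smul_eq_iff 1 g P).2 (by rwa [inv_one, one_mul])
  rwa [map_one, one_smul, eq_comm] at this

lemma conj_smul_eq_of_le [Finite Γ] {P : Subgroup Γ} {a b : Γ}
    (h : MulAut.conj a • P ≤ MulAut.conj b • P) : MulAut.conj a • P = MulAut.conj b • P :=
  Subgroup.eq_of_le_of_card_ge h
    ((Nat.card_congr (Subgroup.equivSMul (MulAut.conj b) P).toEquiv).symm.trans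
      (Nat.card_congr (Subgroup.equivSMul (MulAut.conj a) P).toEquiv)).le

/-- A proper subgroup of a finite `p`-group is properly contained in its normalizer. -/
lemma eq_of_inf_normalizer_eq [Finite Γ] {p : ℕ} [Fact p.Prime] {P K : Subgroup Γ}
    (hK : IsPGroup p K) (h : K ⊓ Subgroup.normalizer (P : Set Γ) = P) : K = P := by
  have hle : P ≤ K := h ▸ inf_le_left
  have := hK.isNilpotent
  have hn := normalizerCondition_iff_only_full_group_self_normalizing.1
    (Group.normalizerCondition_of_isNilpotent (G := K)) (P.subgroupOf K) (by
      rw [← Subgroup.subgroupOf_normalizer_eq hle, ← Subgroup.inf_subgroupOf_left, h])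
  exact le_antisymm (Subgroup.subgroupOf_eq_top.1 hn) hle

namespace ConvexFamily

/-- The conjugacy class of a subgroup. -/
def conjClass [Finite Γ] (P : Subgroup Γ) : ConvexFamily Γ where
  carrier := {R | ∃ g : Γ, MulAut.conj g • P = R}
  conj_mem := by
    rintro g _ ⟨a, rfl⟩
    exact ⟨g * a, by rw [map_mul, mul_smul]⟩
  convex := by
    rintro R Q S h₁ h₂ ⟨a, rfl⟩ ⟨b, rfl⟩
    exact ⟨a, le_antisymm h₁ (h₂.trans (conj_smul_eq_of_le (h₁.trans h₂)).ge)⟩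

end ConvexFamily

variable (P : Subgroup Γ) (X : Type u) [MulAction Γ X]

/-- The support on `(Γ ⧸ N(P)) × X` consisting, at the conjugate `g P g⁻¹`, of the points over the
coset of `g` on which this conjugate acts freely. -/
def cosetSupport : OrbitSupport Γ ((Γ ⧸ Subgroup.normalizer (P : Set Γ)) × X) where
  points R := {z | R ⊓ MulAction.stabilizer Γ z.2 = ⊥ ∧
    ∃ g : Γ, (g : Γ ⧸ Subgroup.normalizer (P : Set Γ)) = z.1 ∧ MulAut.conj g • P = R}
  smul_mem' := by
    rintro g R ⟨t, x⟩ ⟨hx, a, rfl, rfl⟩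
    refine ⟨?_, g * a, rfl, by rw [map_mul, mul_smul]⟩
    change _ ⊓ MulAction.stabilizer Γ (g • x) = ⊥
    rw [ConvexFamily.conj_inf_stabilizer, hx, Subgroup.smul_bot]
  convex := by
    rintro R Q S ⟨t, x⟩ h₁ h₂ ⟨hx, a, rfl, rfl⟩ ⟨-, b, hb, rfl⟩
    have h : MulAut.conj a • P = MulAut.conj b • P :=
      (conj_smul_eq_iff a b P).2 (QuotientGroup.eq.1 hb.symm)
    have hQ : MulAut.conj a • P = Q := le_antisymm h₁ (h ▸ h₂)
    exact ⟨hQ ▸ hx, a, rfl, hQ⟩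

/-- The support on the `N(P)`-set `X` consisting, at `P` only, of the points on which `P` acts
freely. -/
def normalizerSupport : OrbitSupport (Subgroup.normalizer (P : Set Γ)) X where
  points R := {x | P ⊓ MulAction.stabilizer Γ x = ⊥ ∧
    R.map (Subgroup.normalizer (P : Set Γ)).subtype = P}
  smul_mem' := by
    rintro g R x ⟨hx, hR⟩
    have hg : MulAut.conj (g : Γ) • P = P := conj_smul_eq_self g.2
    refine ⟨?_, by rw [map_subtype_conj, hR, hg]⟩
    change P ⊓ MulAction.stabilizer Γ ((g : Γ) • x) = ⊥
    have := ConvexFamily.conj_inf_stabilizer (g : Γ) P x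
    rwa [hg, hx, Subgroup.smul_bot] at this
  convex := by
    rintro R Q S x h₁ h₂ ⟨hx, hR⟩ ⟨-, hS⟩
    exact ⟨hx, le_antisymm ((Subgroup.map_mono h₂).trans hS.le)
      (hR.ge.trans (Subgroup.map_mono h₁))⟩

variable {P X}

/-- The relation between the two supports that Shapiro's lemma requires. It holds at `p`-groups `R`
only: these agree with `P` as soon as their intersections with `N(P)` do. -/
lemma mem_cosetSupport_iff [Finite Γ] {p : ℕ} [Fact p.Prime] (a : Γ) (R : Subgroup Γ) (x : X)
    (hR : IsPGroup p R) :
    (((a⁻¹ : Γ) : Γ ⧸ Subgroup.normalizer (P : Set Γ)), a⁻¹ • x) ∈ (cosetSupport P X).points R ↔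
      x ∈ (normalizerSupport P X).points
        ((MulAut.conj a • R).subgroupOf (Subgroup.normalizer (P : Set Γ))) := by
  have h1 : (∃ g : Γ, (g : Γ ⧸ Subgroup.normalizer (P : Set Γ)) = (a⁻¹ : Γ) ∧
      MulAut.conj g • P = R) ↔ MulAut.conj a • R = P := by
    rw [← eq_inv_smul_iff, ← map_inv]
    refine ⟨?_, fun h => ⟨a⁻¹, rfl, h.symm⟩⟩
    rintro ⟨g, hg, rfl⟩
    exact (conj_smul_eq_iff _ _ _).2 (QuotientGroup.eq.1 hg)
  have h2 : MulAut.conj a • R ⊓ Subgroup.normalizer (P : Set Γ) = P ↔ MulAut.conj a • R = P := by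
    refine ⟨eq_of_inf_normalizer_eq (hR.map _), fun h => ?_⟩
    rw [h]
    exact inf_eq_left.2 Subgroup.le_normalizer
  change R ⊓ MulAction.stabilizer Γ (a⁻¹ • x) = ⊥ ∧ _ ↔ _ ∧ _ = P
  rw [Subgroup.subgroupOf_map_subtype, h2]
  refine (and_congr_right fun _ => h1).trans (and_congr_left fun h => ?_)
  have := ConvexFamily.conj_inf_stabilizer a R (a⁻¹ • x)
  rw [smul_inv_smul, h] at this
  rw [this]
  exact ⟨fun h => by rw [h, Subgroup.smul_bot],
    fun h => by_contra fun hh => conj_smul_ne_bot a hh h⟩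

variable {p : ℕ} (k : Type) [CommRing k]

/-- A conjugate of `P` determines the coset in `Γ ⧸ N(P)` of the conjugating element. -/
lemma nonempty_iso_conjClass [Finite Γ] :
    Nonempty (supportedFunctor k k p ((ConvexFamily.conjClass P).freeSupport X) ≅
      supportedFunctor k k p (cosetSupport P X)) := by
  refine exists_iso_supportedFunctor p k k _ _ Prod.snd (fun _ _ => rfl) ?_ ?_ ?_ ?_
  · rintro R ⟨t, x⟩ ⟨hx, g, -, hg⟩
    exact ⟨hx, g, hg⟩
  · rintro R x ⟨hx, g, hg⟩
    exact ⟨((g : Γ ⧸ Subgroup.normalizer (P : Set Γ)), x), ⟨hx, g, rfl, hg⟩, rfl⟩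
  · rintro R ⟨t, x⟩ ⟨t', x'⟩ ⟨-, g, rfl, hg⟩ ⟨-, g', rfl, hg'⟩ (rfl : x = x')
    refine ⟨1, R.one_mem, ?_⟩
    rw [one_smul]
    exact Prod.ext (QuotientGroup.eq.2 ((conj_smul_eq_iff _ _ _).1 (hg.trans hg'.symm))) rfl
  · rintro Q R ⟨t, x⟩ hQR ⟨hx, g, rfl, rfl⟩ ⟨hx', g', rfl⟩
    exact ⟨hx', g, rfl, conj_smul_eq_of_le hQR⟩

/-- If `N(P)` has a normal `p`-subgroup not contained in `P`, then the functions on the free points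
of the conjugates of `P` are acyclic. -/
lemma subsingleton_ext_conjClass [Finite Γ] [Fact p.Prime] {B : Subgroup Γ} (hB : IsPGroup p B)
    (hBN : B ≤ Subgroup.normalizer (P : Set Γ))
    [(B.subgroupOf (Subgroup.normalizer (P : Set Γ))).Normal] (hBP : ¬ B ≤ P) (n : ℕ) :
    Subsingleton (Ext (constFunctor (OrbitCat p Γ) k)
      (supportedFunctor k k p ((ConvexFamily.conjClass P).freeSupport X)) n) := by
  have : Subsingleton (Ext (constFunctor (OrbitCat p (Subgroup.normalizer (P : Set Γ))) k)
      (supportedFunctor k k p (normalizerSupport P X)) n) := by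
    refine subsingleton_ext_of_normal
      (Q := B.subgroupOf (Subgroup.normalizer (P : Set Γ))) hB.comap_subtype _ (fun S hS => ?_) n
    refine subsingleton_of_forall_eq 0 fun φ => Subtype.ext (funext fun x => ?_)
    refine (φ : supportedValue k k (normalizerSupport P X) S.subgroup).2.2 x fun hx => hBP ?_
    rw [← hx.2]
    exact fun b hb => ⟨⟨b, hBN hb⟩, hS hb, rfl⟩
  have := subsingleton_ext_coinduced (k := k) (V := k) (Subgroup.normalizer (P : Set Γ))
    (mem_cosetSupport_iff (P := P) (X := X) (p := p)) n
  obtain ⟨e⟩ := nonempty_iso_conjClass (p := p) (P := P) (X := X) k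
  exact subsingleton_ext_of_retract e.hom e.inv e.hom_inv_id n

end ConjugacyClass

section OrbitwiseCentralizer

variable {Γ : Type u} [Group Γ] (P : Subgroup Γ) (X : Type u) [MulAction Γ X]

/-- The elements of the centralizer of `P` which map every orbit of `P` into itself. -/
def orbitwiseCentralizer : Subgroup Γ where
  carrier := {σ | (∀ g ∈ P, σ * g = g * σ) ∧ ∀ x : X, ∃ g ∈ P, σ • x = g • x}
  mul_mem' := by
    rintro σ τ ⟨hσ, hσ'⟩ ⟨hτ, hτ'⟩
    refine ⟨fun g hg => by rw [mul_assoc, hτ g hg, ← mul_assoc, hσ g hg, mul_assoc], fun x => ?_⟩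
    obtain ⟨g, hg, hgx⟩ := hτ' x
    obtain ⟨h, hh, hhx⟩ := hσ' x
    exact ⟨g * h, P.mul_mem hg hh, by
      rw [mul_smul, hgx, ← mul_smul, hσ g hg, mul_smul, hhx, mul_smul]⟩
  one_mem' := ⟨fun g _ => by rw [one_mul, mul_one], fun x => ⟨1, P.one_mem, rfl⟩⟩
  inv_mem' := by
    rintro σ ⟨hσ, hσ'⟩
    have hc : ∀ g ∈ P, σ⁻¹ * g = g * σ⁻¹ := fun g hg => by
      rw [inv_mul_eq_iff_eq_mul, ← mul_assoc, hσ g hg, mul_inv_cancel_right]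
    refine ⟨hc, fun x => ?_⟩
    obtain ⟨g, hg, hgx⟩ := hσ' x
    refine ⟨g⁻¹, P.inv_mem hg, ?_⟩
    rw [inv_smul_eq_iff, ← mul_smul, hσ _ (P.inv_mem hg), mul_smul, hgx, inv_smul_smul]

variable {P X}

lemma isPGroup_orbitwiseCentralizer [FaithfulSMul Γ X] [Finite Γ] {p : ℕ} [Fact p.Prime]
    (hP : IsPGroup p P) : IsPGroup p (orbitwiseCentralizer P X) := by
  obtain ⟨n, hn⟩ := IsPGroup.iff_card.1 hP
  rintro ⟨σ, hσ, hσ'⟩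
  refine ⟨n, Subtype.ext (FaithfulSMul.eq_of_smul_eq_smul (α := X) fun x => ?_)⟩
  obtain ⟨g, hg, hgx⟩ := hσ' x
  have h : ∀ m : ℕ, σ ^ m • x = g ^ m • x := by
    intro m
    induction m with
    | zero => rw [pow_zero, pow_zero]
    | succ m ih =>
      have hc : Commute σ (g ^ m) := (show Commute σ g from hσ g hg).pow_right m
      rw [pow_succ', mul_smul, ih, ← mul_smul, hc.eq, mul_smul, hgx, ← mul_smul, ← pow_succ]
  change σ ^ p ^ n • x = (1 : Γ) • x
  have h1 : g ^ p ^ n = 1 := by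
    have := pow_card_eq_one' (x := (⟨g, hg⟩ : P))
    rw [hn] at this
    exact congrArg Subtype.val this
  rw [h, h1]

lemma orbitwiseCentralizer_le_normalizer :
    orbitwiseCentralizer P X ≤ Subgroup.normalizer (P : Set Γ) := by
  rintro σ ⟨hσ, -⟩
  rw [Subgroup.mem_normalizer_iff]
  intro g
  refine ⟨fun hg => ?_, fun hg => ?_⟩
  · rw [hσ g hg, mul_inv_cancel_right]
    exact hg
  · have h := hσ _ hg
    rw [inv_mul_cancel_right, mul_assoc] at h
    rw [← mul_left_cancel h, ← mul_assoc]
    exact hg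

instance : ((orbitwiseCentralizer P X).subgroupOf (Subgroup.normalizer (P : Set Γ))).Normal := by
  refine ⟨fun σ hσ ν => ?_⟩
  obtain ⟨hσ, hσ'⟩ := hσ
  have hν := Subgroup.mem_normalizer_iff''.1 ν.2
  have hν' := Subgroup.mem_normalizer_iff.1 ν.2
  refine ⟨fun g hg => ?_, fun x => ?_⟩
  · have h := hσ _ ((hν g).1 hg)
    change (ν : Γ) * σ * (ν : Γ)⁻¹ * g = g * ((ν : Γ) * σ * (ν : Γ)⁻¹)
    change (σ : Γ) * _ = _ * (σ : Γ) at h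
    have h' := congrArg (fun y => (ν : Γ) * y * (ν : Γ)⁻¹) h
    simpa [mul_assoc] using h'
  · obtain ⟨g, hg, hgx⟩ := hσ' ((ν : Γ)⁻¹ • x)
    refine ⟨ν * g * (ν : Γ)⁻¹, (hν' g).1 hg, ?_⟩
    change ((ν : Γ) * σ * (ν : Γ)⁻¹) • x = _
    change (σ : Γ) • _ = _ at hgx
    rw [mul_smul, mul_smul, hgx, mul_smul, mul_smul]

end OrbitwiseCentralizer

section Perm

variable {X : Type u}

/-- In the full symmetric group, the right multiplications on a free orbit of `P` belong to the
orbitwise centralizer. If all of them belong to `P`, then `P` acts trivially outside of this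
orbit. -/
lemma not_orbitwiseCentralizer_le {P : Subgroup (Equiv.Perm X)} (hne : P ≠ ⊥) {x : X}
    (hx : P ⊓ MulAction.stabilizer (Equiv.Perm X) x = ⊥) (hP : ¬ IsSpecial X P) :
    ¬ orbitwiseCentralizer P X ≤ P := by
  classical
  intro hle
  refine hP ⟨hne, x, hx, fun y => or_iff_not_imp_left.2 fun hy q hq => ?_⟩
  have hinj : Function.Injective fun g : P => (g : Equiv.Perm X) x := by
    intro g h hgh
    have : (h : Equiv.Perm X)⁻¹ * g = 1 := eq_one_of_mem_of_smul_eq hx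
      (P.mul_mem (P.inv_mem h.2) g.2) (by
        rw [mul_smul, inv_smul_eq_iff]
        exact hgh)
    exact Subtype.ext (inv_mul_eq_one.1 this).symm
  let f : P ≃ {y : X // y ∈ Set.range fun g : P => (g : Equiv.Perm X) x} :=
    Equiv.ofInjective _ hinj
  let β : Equiv.Perm X := (Equiv.mulRight (⟨q, hq⟩ : P)).extendDomain f
  have hβ : ∀ g : P, β ((g : Equiv.Perm X) x) = (g : Equiv.Perm X) (q x) := fun g =>
    Equiv.Perm.extendDomain_apply_image (Equiv.mulRight (⟨q, hq⟩ : P)) f g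
  have hβ' : ∀ z, z ∉ Set.range (fun g : P => (g : Equiv.Perm X) x) →
      β z = z := fun z hz =>
    Equiv.Perm.extendDomain_apply_not_subtype (Equiv.mulRight (⟨q, hq⟩ : P)) f hz
  have hmem : β ∈ orbitwiseCentralizer P X := by
    refine ⟨fun g hg => Equiv.ext fun z => ?_, fun z => ?_⟩
    · by_cases hz : z ∈ Set.range fun g : P => (g : Equiv.Perm X) x
      · obtain ⟨h, rfl⟩ := hz
        change β (((⟨g, hg⟩ * h : P) : Equiv.Perm X) x) = g (β (h.1 x))
        rw [hβ, hβ]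
        rfl
      · change β (g z) = g (β z)
        rw [hβ' z hz, hβ' (g z)]
        rintro ⟨h, hh⟩
        refine hz ⟨⟨g, hg⟩⁻¹ * h, ?_⟩
        change g⁻¹ (h.1 x) = z
        rw [Equiv.Perm.inv_eq_iff_eq]
        exact hh
    · by_cases hz : z ∈ Set.range fun g : P => (g : Equiv.Perm X) x
      · obtain ⟨h, rfl⟩ := hz
        refine ⟨h * q * h⁻¹, P.mul_mem (P.mul_mem h.2 hq) (P.inv_mem h.2), ?_⟩
        change β (h.1 x) = h.1 (q (h.1⁻¹ • h.1 • x))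
        rw [hβ, inv_smul_smul]
      · exact ⟨1, P.one_mem, hβ' z hz⟩
  have hβq : q⁻¹ * β = 1 := eq_one_of_mem_of_smul_eq hx (P.mul_mem (P.inv_mem hq) (hle hmem)) (by
    rw [mul_smul, inv_smul_eq_iff]
    exact hβ 1)
  rw [inv_mul_eq_one.1 hβq]
  exact hβ' y fun ⟨g, hg⟩ => hy ⟨g, g.2, hg⟩

variable [Finite X] {p : ℕ} [Fact p.Prime] (k : Type) [CommRing k]

/-- The functions on the free points of a family of subgroups which are not special are acyclic,
by induction on the number of conjugacy classes. -/
lemma subsingleton_ext_freeSupport (n : ℕ) (𝒬 : ConvexFamily (Equiv.Perm X))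
    (h𝒬 : 𝒬.carrier ⊆ (ConvexFamily.nonspecial (Γ := Equiv.Perm X) X).carrier) :
    Subsingleton (Ext (constFunctor (OrbitCat p (Equiv.Perm X)) k)
      (supportedFunctor k k p (𝒬.freeSupport X)) n) := by
  induction hN : 𝒬.carrier.ncard using Nat.strong_induction_on generalizing 𝒬 with
  | _ N ih =>
  subst hN
  have hfin : 𝒬.carrier.Finite := Set.toFinite _
  by_cases hemp : 𝒬.carrier.Nonempty
  swap
  · refine subsingleton_ext_of_normal (Q := ⊥) IsPGroup.of_bot _ (fun S _ => ?_) n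
    refine subsingleton_of_forall_eq 0 fun φ => Subtype.ext (funext fun x => ?_)
    exact (φ : supportedValue k k (𝒬.freeSupport X) S.subgroup).2.2 x fun hx => hemp ⟨_, hx.2⟩
  obtain ⟨P, hP, hmin⟩ := hfin.exists_minimalFor
    (fun R : Subgroup (Equiv.Perm X) => Nat.card R) _ hemp
  have hcard : ∀ g : Equiv.Perm X,
      Nat.card (MulAut.conj g • P : Subgroup (Equiv.Perm X)) = Nat.card P := fun g =>
    (Nat.card_congr (Subgroup.equivSMul (MulAut.conj g) P).toEquiv).symm
  -- a member of the family below a conjugate of `P` is equal to it, by minimality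
  have hmin' : ∀ {Q : Subgroup (Equiv.Perm X)} {g : Equiv.Perm X}, Q ∈ 𝒬.carrier →
      Q ≤ MulAut.conj g • P → MulAut.conj g • P = Q := by
    intro Q g hQ hle
    refine (Subgroup.eq_of_le_of_card_ge hle ?_).symm
    rw [hcard]
    exact not_lt.1 fun hlt => hlt.not_ge (hmin hQ hlt.le)
  let 𝒬' : ConvexFamily (Equiv.Perm X) :=
    { carrier := 𝒬.carrier \ (ConvexFamily.conjClass P).carrier
      conj_mem := fun g R hR => ⟨𝒬.conj_mem g hR.1,
        mt ((ConvexFamily.conjClass P).conj_mem_iff g R).1 hR.2⟩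
      convex := by
        rintro R Q S h₁ h₂ hR hS
        refine ⟨𝒬.convex h₁ h₂ hR.1 hS.1, ?_⟩
        rintro ⟨g, rfl⟩
        exact hR.2 ⟨g, hmin' hR.1 h₁⟩ }
  obtain ⟨f, g, w, hS⟩ : ∃ (f : supportedFunctor k k p ((ConvexFamily.conjClass P).freeSupport X) ⟶
        supportedFunctor k k p (𝒬.freeSupport X))
      (g : supportedFunctor k k p (𝒬.freeSupport X) ⟶ supportedFunctor k k p (𝒬'.freeSupport X))
      (w : f ≫ g = 0), (ShortComplex.mk f g w).ShortExact := by
    refine exists_shortExact_supportedFunctor p k k ?_ ?_ ?_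
    · intro R
      ext x
      constructor
      · rintro ⟨hx, hR⟩
        by_cases h : R ∈ (ConvexFamily.conjClass P).carrier
        · exact Or.inl ⟨hx, h⟩
        · exact Or.inr ⟨hx, hR, h⟩
      · rintro (⟨hx, a, rfl⟩ | ⟨hx, hR, -⟩)
        · exact ⟨hx, 𝒬.conj_mem a hP⟩
        · exact ⟨hx, hR⟩
    · intro R
      rw [Set.disjoint_left]
      exact fun x hx hx' => hx'.2.2 hx.2
    · rintro Q R x - hQR ⟨hx, a, rfl⟩ ⟨hx', hQ⟩
      exact ⟨hx', a, hmin' hQ hQR⟩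
  have h₃ := ih 𝒬'.carrier.ncard (Set.ncard_lt_ncard
    ⟨Set.sdiff_subset, fun h => (h hP).2 ⟨1, by rw [map_one, one_smul]⟩⟩ hfin) 𝒬'
    (Set.sdiff_subset.trans h𝒬) rfl
  have h₁ : Subsingleton (Ext (constFunctor (OrbitCat p (Equiv.Perm X)) k)
      (supportedFunctor k k p ((ConvexFamily.conjClass P).freeSupport X)) n) := by
    by_cases hp : IsPGroup p P
    · obtain ⟨hne, ⟨x, hx⟩, hns⟩ := h𝒬 hP
      exact subsingleton_ext_conjClass k (isPGroup_orbitwiseCentralizer (X := X) hp)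
        orbitwiseCentralizer_le_normalizer (not_orbitwiseCentralizer_le hne hx hns) n
    · -- no conjugate of `P` occurs in the orbit category
      refine subsingleton_ext_of_normal (Q := ⊥) IsPGroup.of_bot _ (fun S _ => ?_) n
      refine subsingleton_of_forall_eq 0 fun φ => Subtype.ext (funext fun x => ?_)
      refine (φ : supportedValue k k ((ConvexFamily.conjClass P).freeSupport X)
        S.subgroup).2.2 x ?_
      rintro ⟨-, a, ha⟩
      refine hp (IsPGroup.of_equiv S.isPGroup ?_)
      rw [← ha]
      exact (Subgroup.equivSMul _ _).symm
  exact subsingleton_ext_X₂ hS _ n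

/-- The functions supported at the trivial subgroup are the kernel of an epimorphism between
functors which are acyclic in positive degrees. -/
theorem subsingleton_ext_atomicFunctor [IsDomain k] [IsNoetherianRing k] [IsLocalRing k]
    (hp : (p : k) ≠ 0) (hp' : (p : k) ∈ IsLocalRing.maximalIdeal k) (n : ℕ) :
    Subsingleton (Ext (constFunctor (OrbitCat p (Equiv.Perm X)) k)
      (atomicFunctor p (Rep.ofMulAction k (Equiv.Perm X) X)) (n + 2)) := by
  let K := constFunctor (OrbitCat p (Equiv.Perm X)) k
  have hs : Subsingleton (Ext K (supportedFunctor k k p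
      ((ConvexFamily.special X).freeSupport X)) (n + 1)) := by
    have := (ConvexFamily.special (Γ := Equiv.Perm X) X).subsingleton_ext_support (p := p)
      (Y := PUnit.{u + 1}) k hp hp' n
    obtain ⟨e⟩ := ConvexFamily.nonempty_iso_special (Γ := Equiv.Perm X) (X := X) (p := p) k
    exact subsingleton_ext_of_retract e.inv e.hom e.inv_hom_id (n + 1)
  have hns := subsingleton_ext_freeSupport (p := p) k (n + 1) (ConvexFamily.nonspecial X) subset_rfl
  obtain ⟨f, g, w, hS⟩ := ConvexFamily.exists_shortExact_nonspecial (Γ := Equiv.Perm X) X p k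
  have hnt := subsingleton_ext_X₂ hS K (n + 1)
  have hfree := (ConvexFamily.trivial (Equiv.Perm X)).subsingleton_ext_support (p := p)
    (Y := X) k hp hp' (n + 1)
  obtain ⟨f', g', w', hS'⟩ := ConvexFamily.exists_shortExact_nontrivial (Γ := Equiv.Perm X) X p k
  have htriv := subsingleton_ext_X₁ hS' K (n + 1)
  obtain ⟨e⟩ := ConvexFamily.nonempty_iso_atomicFunctor (Γ := Equiv.Perm X) X p k
  exact subsingleton_ext_of_retract (X := K) e.hom e.inv e.hom_inv_id (n + 2)

end Perm

end

theorem propositionp (p : ℕ) [Fact p.Prime] (X : Type u) [Finite X] (i : ℕ) (hi : 2 ≤ i) :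
    Limits.IsZero (Lambda p i (Equiv.Perm X) (Rep.ofMulAction ℤ_[p] (Equiv.Perm X) X)) := by
  obtain ⟨n, rfl⟩ := Nat.exists_eq_add_of_le' hi
  have hp : (p : ℤ_[p]) ≠ 0 := Nat.cast_ne_zero.2 (Fact.out : p.Prime).ne_zero
  have hp' : (p : ℤ_[p]) ∈ IsLocalRing.maximalIdeal ℤ_[p] := by
    rw [PadicInt.maximalIdeal_eq_span_p]
    exact Ideal.mem_span_singleton_self _
  have := subsingleton_ext_atomicFunctor (X := X) ℤ_[p] hp hp' n
  exact isZero_higherLimit _ (n + 1)
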